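/- Let $\mathsf P$ (propositional variables) and $\mathsf D$ (actions) be countably infinite sets, the latter with an involution $a\mapsto\breve a$ satisfying $\breve a\neq a$. Let $\Sigma$ be a finite set of tidy alternation-free formulas of the two-way modal $\mu$-calculus (in negation normal form, over $\mathsf P$ and $\mathsf D$) that is closed under negation and under taking closures (Fischer–Ladner closure with unfolding of fixpoints). *Sequents.* A sequent is a finite set of annotated formulas $\varphi^{b}$ ($b\in\{u,f\}$; $\varphi^f$ is "in focus"), trace atoms $\varphi\leadsto\psi$ and negated trace atoms $\varphi\not\leadsto\psi$, with all formulas in $\Sigma$. For $b\in\{u,f\}$, $\Gamma^{b}$ is $\Gamma$ with all annotations replaced by $b$. Let $s(\xi,\Gamma)=f$ if $\xi^f\in\Gamma$ or if $\theta\not\leadsto\xi\in\Gamma$ for some $\theta^f\in\Gamma$; otherwise $s(\xi,\Gamma)=u$. The jump $\Gamma^{[a]\varphi}$ consists of: $\varphi^{s([a]\varphi,\Gamma)}$; $\psi^{s(\langle a\rangle\psi,\Gamma)}$ for $\langle a\rangle\psi^c\in\Gamma$; $[\breve a]\chi^u$ for $\chi^d\in\Gamma$ with $[\breve a]\chi\in\Sigma$;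 and, whenever $\langle\breve a\rangle\chi\in\Sigma$, for $\theta=[a]\varphi$ with $\theta'=\varphi$ and for every $\theta=\langle a\rangle\psi$ with $\theta'=\psi$: $\theta'\leadsto\langle\breve a\rangle\chi$ if $\theta\leadsto\chi\in\Gamma$, and $\langle\breve a\rangle\chi\not\leadsto\theta'$ if $\chi\not\leadsto\theta\in\Gamma$. *Rules of $\mathsf{Focus}^2$* (conclusion $\Leftarrow$ premisses; semicolons separate premisses): axioms $\mathsf{Ax1}$: $\varphi^b,\overline\varphi^c,\Gamma$; $\mathsf{Ax2}$: $\varphi\leadsto\psi,\varphi\not\leadsto\psi,\Gamma$; $\mathsf{Ax3}$: $\varphi\leadsto\varphi,\Gamma$; $\mathsf R_\lor$: $\varphi\lor\psi^b,\Gamma\Leftarrow(\varphi\lor\psi)\not\leadsto\varphi,(\varphi\lor\psi)\not\leadsto\psi,\varphi^b,\psi^b,\Gamma$; $\mathsf R_\land$: $\varphi\land\psi^b,\Gamma\Leftarrow(\varphi\land\psi)\not\leadsto\varphi,\varphi^b,\Gamma\,;\ (\varphi\land\psi)\not\leadsto\psi,\psi^b,\Gamma$; $\mathsf R_\mu$: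 $\mu x\varphi^b,\Gamma\Leftarrow\varphi[\mu x\varphi/x]^u,\Gamma$; $\mathsf R_\nu$: $\nu x\varphi^b,\Gamma\Leftarrow\nu x\varphi\not\leadsto\varphi[\nu x\varphi/x],\ \varphi[\nu x\varphi/x]\leadsto\nu x\varphi,\ \varphi[\nu x\varphi/x]^b,\Gamma$; $\mathsf R_{[a]}$: $[a]\varphi^b,\Gamma\Leftarrow\Gamma^{[a]\varphi}$; $\mathsf F$: $\Gamma^u\Leftarrow\Gamma^f$; $\mathsf{cut}$: $\Gamma\Leftarrow\varphi^u,\Gamma\,;\ \overline\varphi^u,\Gamma$; $\mathsf{tc}$: $\Gamma\Leftarrow\varphi\leadsto\psi,\Gamma\,;\ \varphi\not\leadsto\psi,\Gamma$; $\mathsf{trans}$: $\varphi\not\leadsto\psi,\psi\not\leadsto\chi,\Gamma\Leftarrow\varphi\not\leadsto\psi,\psi\not\leadsto\chi,\varphi\not\leadsto\chi,\Gamma$. A rule instance over $\Sigma$ is a triple $i=(\Gamma,\mathsf r,\langle\Delta_1,\dots,\Delta_n\rangle)$ that is a valid rule application, all formulas being in $\Sigma$. *Proofs.* A $\mathsf{Focus}^2_\infty$-proof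 of $\Gamma$ is a possibly infinite ordered derivation tree over $\Sigma$ with root sequent $\Gamma$ such that all leaves are axioms and every infinite branch has cofinitely many sequents with a formula in focus and infinitely many applications of modal rules $\mathsf R_{[a]}$. It is regular if it has only finitely many non-isomorphic subtrees. Each node is reached by a finite sequence $\Gamma_0 i_0\Gamma_1 i_1\cdots\Gamma_m$ of sequents and rule instances, called its history. Call a proof uniform if nodes with the same history carry the same rule instance (i.e. equal premisses of an instance are treated equally). *Game.* In $\mathcal G(\Sigma)$ the positions are the sequents and the rule instances over $\Sigma$. Prover (player 0) moves from a sequent $\Gamma$ to an instance with conclusion $\Gamma$; Refuter (player 1) moves from an instance to one of its premisses. A player who is stuck loses; an infinite match is won by Prover iff it has a final segment on which every sequent has a formula in focus and modal rules are applied infinitely often. A strategy for a player assigns a position to every finite non-maximal match that ends in a position of this player; it is surviving at $q$ if it assigns an admissible move to each such match starting at $q$, and winning at $q$ if moreover all maximal matches from $q$ that it guides are won by the player. It is positional if it depends only on the last position. For a Prover strategy $f$, a strategy tree of $f$ at $\Gamma$ is a derivation tree with root sequent $\Gamma$ (open leaves allowed) that applies at each node the rule instance that $f$ assigns to the history of the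 node. Then the following hold. 1. $\mathcal G(\Sigma)$ has finitely many positions and is a parity game: the winner of an infinite match is the parity of the greatest priority that occurs infinitely often, for the priority map $\Omega$ that is $0$ on sequents and, on an instance with conclusion $\Gamma$ and rule $\mathsf r$, is $3$ if $\Gamma$ has no formula in focus, $2$ if it has one and $\mathsf r$ is modal, and $1$ if it has one and $\mathsf r$ is not modal. It is positionally determined: there are positional strategies for the two players such that at every position one of them is winning. 2. For every sequent $\Gamma$, proofs of $\Gamma$ correspond to winning strategies for Prover in $\mathcal G(\Sigma)@\Gamma$: (a) every Prover strategy $f$ that is surviving at $\Gamma$ has a unique strategy tree at $\Gamma$, and $f$ is winning at $\Gamma$ iff this tree is a $\mathsf{Focus}^2_\infty$-proof of $\Gamma$; (b) two Prover strategies that are surviving at $\Gamma$ have the same strategy tree iff they agree on all matches from $\Gamma$ guided by the first that are finite, non-maximal and end at a Prover position; (c) a proof of $\Gamma$ is the strategy tree of a strategy winning at $\Gamma$ iff it is uniform; (d) for every proof $\pi$ of $\Gamma$, uniform or not, there is a Prover strategy $f$ winning at $\Gamma$ that plays inside $\pi$: every $f$-guided finite non-maximal match from $\Gamma$ that ends at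 a Prover position is the history of a node of $\pi$ that carries the instance chosen by $f$; (e) in particular, $\Gamma$ has a proof iff Prover has a winning strategy in $\mathcal G(\Sigma)@\Gamma$. 3. For every sequent $\Gamma$, the strategy tree of a positional Prover strategy winning at $\Gamma$ is a regular proof of $\Gamma$; and if $\Gamma$ has a $\mathsf{Focus}^2_\infty$-proof, then Prover has a positional winning strategy in $\mathcal G(\Sigma)@\Gamma$ and $\Gamma$ has a regular $\mathsf{Focus}^2_\infty$-proof. -/

import Mathlib

namespace FocusTwo

/-! ### Formulas of the two-way modal mu-calculus -/

/-- A set of actions with a fixed-point free involution, the converse of an action. -/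
class TwoWayActions (D : Type*) where
  conv : D → D
  conv_ne : ∀ a, conv a ≠ a
  conv_conv : ∀ a, conv (conv a) = a

/-- The two fixpoint operators. -/
inductive FixOp where
  | mu
  | nu

/-- The opposite fixpoint operator. -/
def FixOp.dual : FixOp → FixOp
  | .mu => .nu
  | .nu => .mu

/-- Raw formulas in negation normal form; `nvar p` is the negated variable. -/
inductive Formula (P D : Type*) where
  | var (p : P)
  | nvar (p : P)
  | or (φ ψ : Formula P D)
  | and (φ ψ : Formula P D)
  | dia (a : D) (φ : Formula P D)
  | box (a : D) (φ : Formula P D)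
  | fix (η : FixOp) (x : P) (φ : Formula P D)

noncomputable instance {P D : Type*} : DecidableEq (Formula P D) := Classical.decEq _

namespace Formula

variable {P D : Type*}

/-- Free variables (a negated variable counts as a free occurrence). -/
def FV : Formula P D → Set P
  | var p => {p}
  | nvar p => {p}
  | or φ ψ => FV φ ∪ FV ψ
  | and φ ψ => FV φ ∪ FV ψ
  | dia _ φ => FV φ
  | box _ φ => FV φ
  | fix _ x φ => FV φ \ {x}

/-- Bound variables. -/
def BV : Formula P D → Set P
  | var _ => ∅
  | nvar _ => ∅
  | or φ ψ => BV φ ∪ BV ψ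
  | and φ ψ => BV φ ∪ BV ψ
  | dia _ φ => BV φ
  | box _ φ => BV φ
  | fix _ x φ => insert x (BV φ)

/-- The negated variable of `x` occurs in the formula. -/
def NegOccurs (x : P) : Formula P D → Prop
  | var _ => False
  | nvar p => p = x
  | or φ ψ => NegOccurs x φ ∨ NegOccurs x ψ
  | and φ ψ => NegOccurs x φ ∨ NegOccurs x ψ
  | dia _ φ => NegOccurs x φ
  | box _ φ => NegOccurs x φ
  | fix _ _ φ => NegOccurs x φ

/-- The formation condition of the grammar: in `η x φ` the negated variable of `x` does not
occur in `φ`. -/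
def WellFormed : Formula P D → Prop
  | var _ => True
  | nvar _ => True
  | or φ ψ => WellFormed φ ∧ WellFormed ψ
  | and φ ψ => WellFormed φ ∧ WellFormed ψ
  | dia _ φ => WellFormed φ
  | box _ φ => WellFormed φ
  | fix _ x φ => WellFormed φ ∧ ¬ NegOccurs x φ

/-- No variable is both free and bound. -/
def Tidy (φ : Formula P D) : Prop := Disjoint φ.FV φ.BV

/-- Some free occurrence of `x` in the formula lies in the scope of an `η`-operator. -/
def FreeInScope (η : FixOp) (x : P) : Formula P D → Prop
  | var _ => False
  | nvar _ => False
  | or φ ψ => FreeInScope η x φ ∨ FreeInScope η x ψ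
  | and φ ψ => FreeInScope η x φ ∨ FreeInScope η x ψ
  | dia _ φ => FreeInScope η x φ
  | box _ φ => FreeInScope η x φ
  | fix η' y φ => x ≠ y ∧ ((η' = η ∧ x ∈ φ.FV) ∨ FreeInScope η x φ)

/-- For every subformula `η x φ`, no free occurrence of `x` in `φ` is in the scope of an operator
opposite to `η`. -/
def AlternationFree : Formula P D → Prop
  | var _ => True
  | nvar _ => True
  | or φ ψ => AlternationFree φ ∧ AlternationFree ψ
  | and φ ψ => AlternationFree φ ∧ AlternationFree ψ
  | dia _ φ => AlternationFree φ
  | box _ φ => AlternationFree φ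
  | fix η x φ => AlternationFree φ ∧ ¬ FreeInScope η.dual x φ

open scoped Classical in
/-- `φ.subst x ψ` replaces every free occurrence of the variable `x` in `φ` by `ψ`. (It is only
used for unfolding tidy formulas, where no variable is captured.) -/
noncomputable def subst (x : P) (ψ : Formula P D) : Formula P D → Formula P D
  | var p => if p = x then ψ else var p
  | nvar p => nvar p
  | or φ χ => or (subst x ψ φ) (subst x ψ χ)
  | and φ χ => and (subst x ψ φ) (subst x ψ χ)
  | dia a φ => dia a (subst x ψ φ)
  | box a φ => box a (subst x ψ φ)
  | fix η y φ => fix η y (if y = x then φ else subst x ψ φ)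

/-- The unfolding `φ[η x φ / x]` of `η x φ`. -/
noncomputable def unfold (η : FixOp) (x : P) (φ : Formula P D) : Formula P D :=
  subst x (fix η x φ) φ

open scoped Classical in
/-- Negation relative to a set `B` of variables that are currently bound: connectives, modalities
and fixpoint operators are dualised, free literals are complemented, bound variables are kept. -/
noncomputable def negAux : Set P → Formula P D → Formula P D
  | B, var p => if p ∈ B then var p else nvar p
  | B, nvar p => if p ∈ B then nvar p else var p
  | B, or φ ψ => and (negAux B φ) (negAux B ψ)
  | B, and φ ψ => or (negAux B φ) (negAux B ψ)
  | B, dia a φ => box a (negAux B φ)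
  | B, box a φ => dia a (negAux B φ)
  | B, fix η x φ => fix η.dual x (negAux (insert x B) φ)

/-- The negation of a formula. -/
noncomputable def neg (φ : Formula P D) : Formula P D := negAux ∅ φ

/-- `InClos ξ φ`: the formula `φ` belongs to the closure of `ξ`. -/
inductive InClos (ξ : Formula P D) : Formula P D → Prop
  | base : InClos ξ ξ
  | or_left {φ ψ} : InClos ξ (or φ ψ) → InClos ξ φ
  | or_right {φ ψ} : InClos ξ (or φ ψ) → InClos ξ ψ
  | and_left {φ ψ} : InClos ξ (and φ ψ) → InClos ξ φ
  | and_right {φ ψ} : InClos ξ (and φ ψ) → InClos ξ ψ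
  | dia {a φ} : InClos ξ (dia a φ) → InClos ξ φ
  | box {a φ} : InClos ξ (box a φ) → InClos ξ φ
  | fix {η x φ} : InClos ξ (fix η x φ) → InClos ξ (unfold η x φ)

end Formula

/-- The (tidy) formulas of the alternation-free two-way modal mu-calculus. -/
def IsAFFormula {P D : Type*} (φ : Formula P D) : Prop :=
  φ.WellFormed ∧ φ.Tidy ∧ φ.AlternationFree

/-- Closed under negation and under taking closures. -/
def NegationClosed {P D : Type*} (Sig : Finset (Formula P D)) : Prop :=
  ∀ ξ ∈ Sig, ξ.neg ∈ Sig ∧ ∀ φ, Formula.InClos ξ φ → φ ∈ Sig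

/-! ### Sequents -/

/-- Focus annotations: out of focus (`u`) and in focus (`f`). -/
inductive Ann where
  | u
  | f

/-- The elements of sequents: annotated formulas, trace atoms and negated trace atoms. -/
inductive Item (P D : Type*) where
  | ann (φ : Formula P D) (b : Ann)
  | tr (φ ψ : Formula P D)
  | ntr (φ ψ : Formula P D)

noncomputable instance {P D : Type*} : DecidableEq (Item P D) := Classical.decEq _

/-- All formulas occurring in the item belong to `Sig`. -/
def Item.Over {P D : Type*} (Sig : Finset (Formula P D)) : Item P D → Prop
  | .ann φ _ => φ ∈ Sig
  | .tr φ ψ => φ ∈ Sig ∧ ψ ∈ Sig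
  | .ntr φ ψ => φ ∈ Sig ∧ ψ ∈ Sig

/-- Replace the annotation of an annotated formula; trace atoms are unchanged. -/
def Item.setAnn {P D : Type*} (b : Ann) : Item P D → Item P D
  | .ann φ _ => .ann φ b
  | .tr φ ψ => .tr φ ψ
  | .ntr φ ψ => .ntr φ ψ

/-- Finite sets of annotated formulas, trace atoms and negated trace atoms. -/
abbrev Sequent (P D : Type*) := Finset (Item P D)

namespace Sequent

variable {P D : Type*}

/-- Only formulas from `Sig` occur in the sequent. -/
def Over (Sig : Finset (Formula P D)) (Γ : Sequent P D) : Prop := ∀ A ∈ Γ, A.Over Sig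

/-- Give all annotated formulas the annotation `b`, keeping all (negated) trace atoms. -/
noncomputable def setAnn (b : Ann) (Γ : Sequent P D) : Sequent P D := Finset.image (Item.setAnn b) Γ

/-- Some formula of the sequent is in focus. -/
def HasFocus (Γ : Sequent P D) : Prop := ∃ φ, Item.ann φ .f ∈ Γ

open scoped Classical in
/-- The annotation `s(ξ, Γ)` used in the modal rule. -/
noncomputable def focusOf (ξ : Formula P D) (Γ : Sequent P D) : Ann :=
  if Item.ann ξ .f ∈ Γ ∨ ∃ θ, Item.ntr θ ξ ∈ Γ ∧ Item.ann θ .f ∈ Γ then .f else .u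

variable [TwoWayActions D]

open TwoWayActions

/-- The members of the jump of `Γ` with respect to `[a]φ`. -/
def jumpSet (Sig : Finset (Formula P D)) (Γ : Sequent P D) (a : D) (φ : Formula P D) :
    Set (Item P D) :=
  {A | A = .ann φ (focusOf (.box a φ) Γ)} ∪
  {A | ∃ ψ c, .ann (.dia a ψ) c ∈ Γ ∧ A = .ann ψ (focusOf (.dia a ψ) Γ)} ∪
  {A | ∃ χ d, .ann χ d ∈ Γ ∧ .box (conv a) χ ∈ Sig ∧ A = .ann (.box (conv a) χ) .u} ∪
  {A | ∃ χ, .tr (.box a φ) χ ∈ Γ ∧ .dia (conv a) χ ∈ Sig ∧ A = .tr φ (.dia (conv a) χ)} ∪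
  {A | ∃ χ, .ntr χ (.box a φ) ∈ Γ ∧ .dia (conv a) χ ∈ Sig ∧ A = .ntr (.dia (conv a) χ) φ} ∪
  {A | ∃ ψ χ, .tr (.dia a ψ) χ ∈ Γ ∧ .dia (conv a) χ ∈ Sig ∧ A = .tr ψ (.dia (conv a) χ)} ∪
  {A | ∃ ψ χ, .ntr χ (.dia a ψ) ∈ Γ ∧ .dia (conv a) χ ∈ Sig ∧ A = .ntr (.dia (conv a) χ) ψ}

theorem jumpSet_finite (Sig : Finset (Formula P D)) (Γ : Sequent P D) (a : D) (φ : Formula P D) :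
    (jumpSet Sig Γ a φ).Finite := by
  have key : ∀ (g : Item P D → Item P D) (s : Set (Item P D)),
      (∀ A ∈ s, ∃ B ∈ Γ, g B = A) → s.Finite := fun g s h =>
    (Γ.finite_toSet.image g).subset fun A hA => by
      obtain ⟨B, hB, e⟩ := h A hA
      exact ⟨B, hB, e⟩
  unfold jumpSet
  refine Set.Finite.union (Set.Finite.union (Set.Finite.union (Set.Finite.union (Set.Finite.union
    (Set.Finite.union (Set.finite_singleton _) ?_) ?_) ?_) ?_) ?_) ?_
  · refine key (fun B => match B with
      | .ann (.dia a ψ) _ => .ann ψ (focusOf (.dia a ψ) Γ)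
      | B => B) _ ?_
    rintro A ⟨ψ, c, h, rfl⟩
    exact ⟨_, h, rfl⟩
  · refine key (fun B => match B with
      | .ann χ _ => .ann (.box (conv a) χ) .u
      | B => B) _ ?_
    rintro A ⟨χ, d, h, -, rfl⟩
    exact ⟨_, h, rfl⟩
  · refine key (fun B => match B with
      | .tr _ χ => .tr φ (.dia (conv a) χ)
      | B => B) _ ?_
    rintro A ⟨χ, h, -, rfl⟩
    exact ⟨_, h, rfl⟩
  · refine key (fun B => match B with
      | .ntr χ _ => .ntr (.dia (conv a) χ) φ
      | B => B) _ ?_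
    rintro A ⟨χ, h, -, rfl⟩
    exact ⟨_, h, rfl⟩
  · refine key (fun B => match B with
      | .tr (.dia _ ψ) χ => .tr ψ (.dia (conv a) χ)
      | B => B) _ ?_
    rintro A ⟨ψ, χ, h, -, rfl⟩
    exact ⟨_, h, rfl⟩
  · refine key (fun B => match B with
      | .ntr χ (.dia _ ψ) => .ntr (.dia (conv a) χ) ψ
      | B => B) _ ?_
    rintro A ⟨ψ, χ, h, -, rfl⟩
    exact ⟨_, h, rfl⟩

/-- The jump of `Γ` with respect to `[a]φ`, as a sequent. -/
noncomputable def jump (Sig : Finset (Formula P D)) (Γ : Sequent P D) (a : D) (φ : Formula P D) :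
    Sequent P D := (jumpSet_finite Sig Γ a φ).toFinset

end Sequent

/-! ### Rules -/

/-- Names of the rules. -/
inductive Rule (D : Type*) where
  | ax1 | ax2 | ax3 | or | and | mu | nu | cut | foc | trans | tc
  | box (a : D)

/-- The axioms. -/
def Rule.IsAxiom {D : Type*} (r : Rule D) : Prop := r = .ax1 ∨ r = .ax2 ∨ r = .ax3

/-- The modal rules. -/
def Rule.IsModal {D : Type*} (r : Rule D) : Prop := ∃ a, r = .box a

/-- `RuleApp Sig Γ r Δs`: the rule `r` may be applied with conclusion `Γ` and list of premisses
`Δs`. Since sequents are sets, a principal item may also occur among the side items. -/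
inductive RuleApp {P D : Type*} [TwoWayActions D] (Sig : Finset (Formula P D)) :
    Sequent P D → Rule D → List (Sequent P D) → Prop
  | ax1 (φ b c Γ) : RuleApp Sig ({.ann φ b, .ann φ.neg c} ∪ Γ) .ax1 []
  | ax2 (φ ψ Γ) : RuleApp Sig ({.tr φ ψ, .ntr φ ψ} ∪ Γ) .ax2 []
  | ax3 (φ Γ) : RuleApp Sig ({.tr φ φ} ∪ Γ) .ax3 []
  | or (φ ψ b Γ) : RuleApp Sig ({.ann (.or φ ψ) b} ∪ Γ) .or
      [{.ntr (.or φ ψ) φ, .ntr (.or φ ψ) ψ, .ann φ b, .ann ψ b} ∪ Γ]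
  | cut (φ Γ) : RuleApp Sig Γ .cut [{.ann φ .u} ∪ Γ, {.ann φ.neg .u} ∪ Γ]
  | and (φ ψ b Γ) : RuleApp Sig ({.ann (.and φ ψ) b} ∪ Γ) .and
      [{.ntr (.and φ ψ) φ, .ann φ b} ∪ Γ, {.ntr (.and φ ψ) ψ, .ann ψ b} ∪ Γ]
  | mu (x φ b Γ) : RuleApp Sig ({.ann (.fix .mu x φ) b} ∪ Γ) .mu
      [{.ann (.unfold .mu x φ) .u} ∪ Γ]
  | nu (x φ b Γ) : RuleApp Sig ({.ann (.fix .nu x φ) b} ∪ Γ) .nu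
      [{.ntr (.fix .nu x φ) (.unfold .nu x φ), .tr (.unfold .nu x φ) (.fix .nu x φ),
        .ann (.unfold .nu x φ) b} ∪ Γ]
  | box (a φ b Γ) : RuleApp Sig ({.ann (.box a φ) b} ∪ Γ) (.box a) [Γ.jump Sig a φ]
  | foc (Γ : Sequent P D) : RuleApp Sig (Γ.setAnn .u) .foc [Γ.setAnn .f]
  | trans (φ ψ χ Γ) : RuleApp Sig ({.ntr φ ψ, .ntr ψ χ} ∪ Γ) .trans
      [{.ntr φ ψ, .ntr ψ χ, .ntr φ χ} ∪ Γ]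
  | tc (φ ψ Γ) : RuleApp Sig Γ .tc [{.tr φ ψ} ∪ Γ, {.ntr φ ψ} ∪ Γ]

/-- Sequents in which only formulas from `Sig` occur. -/
def SeqOver {P D : Type*} (Sig : Finset (Formula P D)) := {Γ : Sequent P D // Γ.Over Sig}

/-- Rule instances in which only formulas from `Sig` occur. -/
structure InstOver {P D : Type*} [TwoWayActions D] (Sig : Finset (Formula P D)) where
  conc : SeqOver Sig
  rule : Rule D
  prem : List (SeqOver Sig)
  valid : RuleApp Sig conc.1 rule (prem.map Subtype.val)

/-! ### Derivations and proofs -/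

/-- A node of a derivation: either an open leaf, or the conclusion of a rule instance. -/
inductive Node {P D : Type*} [TwoWayActions D] (Sig : Finset (Formula P D)) where
  | opn (Γ : SeqOver Sig)
  | app (i : InstOver Sig)

/-- The sequent at a node. -/
def Node.conc {P D : Type*} [TwoWayActions D] {Sig : Finset (Formula P D)} : Node Sig → SeqOver Sig
  | .opn Γ => Γ
  | .app i => i.conc

/-- The sequents at the children of a node. -/
def Node.prem {P D : Type*} [TwoWayActions D] {Sig : Finset (Formula P D)} :
    Node Sig → List (SeqOver Sig)
  | .opn _ => []
  | .app i => i.prem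

/-- A possibly infinite derivation: an ordered labelled tree whose nodes are addressed by lists of
child indices (starting at the root), `none` marking the addresses outside the tree. The node
`p ++ [k]` exists precisely if the node `p` exists and has a premiss with index `k`, and it then
carries this premiss. -/
@[ext]
structure DerivTree {P D : Type*} [TwoWayActions D] (Sig : Finset (Formula P D)) where
  label : List ℕ → Option (Node Sig)
  root : (label []).isSome
  child : ∀ p k, (label (p ++ [k])).map Node.conc = (label p).bind fun n => n.prem[k]?

namespace DerivTree

variable {P D : Type*} [TwoWayActions D] {Sig : Finset (Formula P D)}

/-- The sequent at the root is `Γ`. -/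
def Concludes (π : DerivTree Sig) (Γ : SeqOver Sig) : Prop := (π.label []).map Node.conc = some Γ

/-- `x` gives the child indices along an infinite branch. -/
def IsBranch (π : DerivTree Sig) (x : ℕ → ℕ) : Prop :=
  ∀ n, (π.label ((List.range n).map x)).isSome

/-- All leaves are axioms, and every infinite branch has cofinitely many sequents with a formula in
focus and infinitely many applications of the modal rule. -/
structure IsProof (π : DerivTree Sig) : Prop where
  leaf : ∀ p n, π.label p = some n → n.prem = [] → ∃ i : InstOver Sig, n = .app i ∧ i.rule.IsAxiom
  focus : ∀ x, π.IsBranch x → ∀ᶠ k in Filter.atTop, ∀ n, π.label ((List.range k).map x) = some n →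
    n.conc.1.HasFocus
  modal : ∀ x, π.IsBranch x → ∃ᶠ k in Filter.atTop, ∃ i : InstOver Sig,
    π.label ((List.range k).map x) = some (.app i) ∧ i.rule.IsModal

/-- `π` is a proof of `Γ`. -/
def IsProofOf (π : DerivTree Sig) (Γ : SeqOver Sig) : Prop := π.Concludes Γ ∧ π.IsProof

/-- There are only finitely many subtrees up to isomorphism. As nodes are addressed by child
indices, two subtrees are isomorphic (as ordered labelled trees) iff their labelings agree. -/
def Regular (π : DerivTree Sig) : Prop :=
  {t : List ℕ → Option (Node Sig) | ∃ p, (π.label p).isSome ∧ t = fun q => π.label (p ++ q)}.Finite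

end DerivTree

/-! ### Games -/

/-- Two-player games; the players are `0` and `1`. -/
structure Game where
  Board : Type*
  owner : Board → Fin 2
  E : Board → Board → Prop
  W : (ℕ → Board) → Fin 2

namespace Game

variable (G : Game)

/-- Finite matches: nonempty finite paths. -/
def IsMatch (M : List G.Board) : Prop := M ≠ [] ∧ M.IsChain G.E

/-- Finite matches that cannot be extended. -/
def IsFull (M : List G.Board) : Prop := G.IsMatch M ∧ ∀ b ∈ M.getLast?, ∀ c, ¬ G.E b c

/-- Infinite matches. -/
def IsInfMatch (M : ℕ → G.Board) : Prop := ∀ n, G.E (M n) (M (n + 1))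

/-- Partial (that is, not full) matches whose last position belongs to player `pl`. -/
def IsPM (pl : Fin 2) (M : List G.Board) : Prop :=
  G.IsMatch M ∧ ¬ G.IsFull M ∧ ∀ b ∈ M.getLast?, G.owner b = pl

/-- Strategies for player `pl`. -/
def Strategy (pl : Fin 2) := {M : List G.Board // G.IsPM pl M} → G.Board

/-- Parity games with priority map `Ω`: the map has finite range, and the winner of an infinite
match is the parity of the greatest priority that occurs infinitely often. -/
def IsParity (Ω : G.Board → ℕ) : Prop :=
  (Set.range Ω).Finite ∧ ∀ M, G.IsInfMatch M →
    ∃ m, IsGreatest {k | ∃ᶠ n in Filter.atTop, Ω (M n) = k} m ∧ (G.W M : ℕ) = m % 2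

variable {G} {pl : Fin 2}

namespace Strategy

/-- The finite match `M` is guided by `f`. -/
def Guides (f : G.Strategy pl) (M : List G.Board) : Prop :=
  ∀ M₀ : {M : List G.Board // G.IsPM pl M}, M₀.1 <+: M → M₀.1 ≠ M → M₀.1 ++ [f M₀] <+: M

/-- The infinite match `M` is guided by `f`. -/
def GuidesInf (f : G.Strategy pl) (M : ℕ → G.Board) : Prop :=
  ∀ n (h : G.IsPM pl ((List.range (n + 1)).map M)), f ⟨_, h⟩ = M (n + 1)

/-- The strategy always chooses admissible moves in matches starting at `q`. -/
def SurvivingAt (f : G.Strategy pl) (q : G.Board) : Prop :=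
  ∀ M : {M : List G.Board // G.IsPM pl M}, M.1.head? = some q → ∀ b ∈ M.1.getLast?, G.E b (f M)

/-- The strategy is winning in the game initialised at `q`. -/
structure WinningAt (f : G.Strategy pl) (q : G.Board) : Prop where
  surviving : f.SurvivingAt q
  fin : ∀ M, G.IsFull M → M.head? = some q → f.Guides M → ∀ b ∈ M.getLast?, G.owner b ≠ pl
  inf : ∀ M, G.IsInfMatch M → M 0 = q → f.GuidesInf M → G.W M = pl

/-- The strategy only depends on the last position. -/
def Positional (f : G.Strategy pl) : Prop :=
  ∀ M M' : {M : List G.Board // G.IsPM pl M}, M.1.getLast? = M'.1.getLast? → f M = f M'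

end Strategy

/-- The players have positional strategies such that at every position one of them is winning. -/
def PositionallyDetermined (G : Game) : Prop :=
  ∃ f : ∀ pl : Fin 2, G.Strategy pl, (∀ pl, (f pl).Positional) ∧ ∀ q, ∃ pl, (f pl).WinningAt q

end Game

/-! ### The proof search game -/

section ProofSearch

variable {P D : Type*} [TwoWayActions D] (Sig : Finset (Formula P D))

/-- The moves: Prover moves from a sequent to a rule instance with this conclusion, Refuter from a
rule instance to one of its premisses. -/
def searchMove : SeqOver Sig ⊕ InstOver Sig → SeqOver Sig ⊕ InstOver Sig → Prop
  | .inl Γ, .inr i => i.conc = Γ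
  | .inr i, .inl Δ => Δ ∈ i.prem
  | _, _ => False

/-- From some point on every sequent of the match has a formula in focus, and the modal rule is
applied infinitely often. -/
def ProverCondition (M : ℕ → SeqOver Sig ⊕ InstOver Sig) : Prop :=
  (∃ N, ∀ n ≥ N, ∀ Γ : SeqOver Sig, M n = .inl Γ → Γ.1.HasFocus) ∧
    ∃ᶠ n in Filter.atTop, ∃ i : InstOver Sig, M n = .inr i ∧ i.rule.IsModal

open scoped Classical in
/-- The proof search game; Prover is player `0` and Refuter is player `1`. -/
noncomputable def searchGame : Game where
  Board := SeqOver Sig ⊕ InstOver Sig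
  owner := Sum.elim (fun _ => 0) (fun _ => 1)
  E := searchMove Sig
  W := fun M => if ProverCondition Sig M then 0 else 1

open scoped Classical in
/-- The priority map of the proof search game. -/
noncomputable def searchPriority : (searchGame Sig).Board → ℕ
  | .inl _ => 0
  | .inr i => if ¬ i.conc.1.HasFocus then 3 else if i.rule.IsModal then 2 else 1

/-- Strategies of Prover. -/
abbrev ProverStrategy := (searchGame Sig).Strategy 0

/-- The position of the game given by a sequent. -/
def seqPos {Sig : Finset (Formula P D)} (Γ : SeqOver Sig) : (searchGame Sig).Board := Sum.inl Γ

variable {Sig}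

/-- The sequent at a node followed by the rule instance applied there (if any), as positions. -/
def Node.moves : Node Sig → List (searchGame Sig).Board
  | .opn Γ => [.inl Γ]
  | .app i => [.inl i.conc, .inr i]

/-- The path of a derivation from the root to the sequent at the node `p`, read as a match
`Γ₀ i₀ Γ₁ i₁ ⋯ Γₘ`. -/
def DerivTree.matchTo (π : DerivTree Sig) (p : List ℕ) : List (searchGame Sig).Board :=
  ((List.range p.length).flatMap fun k => ((π.label (p.take k)).map Node.moves).getD []) ++
    ((π.label p).map fun n => seqPos n.conc).toList

/-- `π` is the derivation of `Γ` obtained by viewing the strategy `f` in the game initialised at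
`Γ` as a tree: at each node, the rule instance that is applied is the one that `f` chooses after
the match that leads to this node. -/
def IsStrategyTree (f : ProverStrategy Sig) (Γ : SeqOver Sig) (π : DerivTree Sig) : Prop :=
  π.Concludes Γ ∧ ∀ p n, π.label p = some n →
    ∀ h : (searchGame Sig).IsPM 0 (π.matchTo p), ∃ i, f ⟨_, h⟩ = Sum.inr i ∧ n = .app i

/-- The derivation treats equal premisses of a rule instance equally: nodes that are reached by the
same sequence of sequents and rule instances carry the same rule instance. -/
def DerivTree.Uniform (π : DerivTree Sig) : Prop :=
  ∀ p q, (π.label p).isSome → (π.label q).isSome → π.matchTo p = π.matchTo q →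
    π.label p = π.label q

end ProofSearch

end FocusTwo

open FocusTwo

/-! The game is finite: there are finitely many sequents over `Sig`, an instance has at most two
premisses, and the action of a modal rule occurs in a formula of `Sig`. Prover's condition is a
parity condition because in an infinite match each sequent is directly followed by an instance with
that conclusion, so that focus can be read off the instances: priority 3 records missing focus and 2
a modal step in focus. Positional determinacy is Zielonka's recursion on subgames
(`exists_winRegions`), transferred by `IsParity.positionallyDetermined` to games with dead ends and
to strategies that see the whole match.

A node of a derivation determines a history, and an infinite branch corresponds to an infinite match
through the same sequents and instances (`Tracks`). The two notions differ in one point: Refuter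
chooses a premiss as a sequent, whereas a tree distinguishes equal premisses by their indices.
Several nodes may therefore share a history, and a strategy must treat them alike; this is why
uniformity characterises strategy trees among proofs. In an arbitrary proof one keeps only the
addresses that always use the first occurrence of a premiss. They still answer every move of Refuter
(`covers_isFirst`) and are determined by their histories (`IsFirst.eq_of_matchTo_eq`), so a strategy
can be read off them. `Follows` and `Covers` handle this case and the uniform case together.

Conversely, a surviving strategy unfolds into a tree, and winning infinite matches gives the branch
conditions (`IsStrategyTree.isProofOf`); leaves are axioms because every other rule has a premiss.

For regularity, a proof yields a winning strategy for Prover, so Refuter has none, and determinacy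
provides a positional one for Prover. In its tree the sequent at a node determines the whole
subtree, and there are finitely many sequents. -/

namespace FocusTwo

/-! ### Positional determinacy of finite parity games -/

section Zielonka

open Filter

variable {V : Type*} {owner : V → Fin 2} {E : V → V → Prop} {Ω : V → ℕ}

/-- The greatest priority occurring infinitely often on `M` has the parity of the player `i`. -/
def ParityWins (Ω : V → ℕ) (i : Fin 2) (M : ℕ → V) : Prop :=
  ∃ m, m % 2 = (i : ℕ) ∧ (∃ᶠ n in atTop, Ω (M n) = m) ∧ ∀ᶠ n in atTop, Ω (M n) ≤ m

/-- The condition ignores finite prefixes. Composite strategies rely on this: they obey a given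
winning strategy only from some point on. -/
theorem ParityWins.of_tail {i : Fin 2} {M : ℕ → V} (k : ℕ)
    (h : ParityWins Ω i fun n => M (n + k)) : ParityWins Ω i M := by
  obtain ⟨m, h1, h2, h3⟩ := h
  refine ⟨m, h1, ?_, ?_⟩
  · rw [frequently_atTop] at h2 ⊢
    intro a
    obtain ⟨b, hb, e⟩ := h2 a
    exact ⟨b + k, by omega, e⟩
  · rw [eventually_atTop] at h3 ⊢
    obtain ⟨a, ha⟩ := h3
    refine ⟨a + k, fun b hb => ?_⟩
    have := ha (b - k) (by omega)
    dsimp only at this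
    rwa [Nat.sub_add_cancel (by omega)] at this

/-- `σ` is a positional winning strategy of player `i` on the region `W` of the subgame `S`. -/
structure WinRegion (owner : V → Fin 2) (E : V → V → Prop) (Ω : V → ℕ) (S W : Set V) (i : Fin 2)
    (σ : V → V) : Prop where
  sub : W ⊆ S
  own : ∀ v ∈ W, owner v = i → E v (σ v) ∧ σ v ∈ W
  opp : ∀ v ∈ W, owner v ≠ i → ∀ w ∈ S, E v w → w ∈ W
  win : ∀ M : ℕ → V, (∀ n, M n ∈ W) → (∀ n, E (M n) (M (n + 1))) →
    (∀ n, owner (M n) = i → M (n + 1) = σ (M n)) → ParityWins Ω i M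

theorem WinRegion.empty (S : Set V) (i : Fin 2) (σ : V → V) :
    WinRegion owner E Ω S ∅ i σ :=
  ⟨by simp, by simp, by simp, fun _ h => (h 0).elim⟩

/-- `A` is the attractor of `T` for player `i` in the subgame `S`, ranked by `r`. -/
structure IsAttractor (owner : V → Fin 2) (E : V → V → Prop) (S T : Set V) (i : Fin 2)
    (A : Set V) (r : V → ℕ) : Prop where
  target : T ⊆ A
  sub : A ⊆ S
  own : ∀ v ∈ A, v ∉ T → owner v = i → ∃ w ∈ A, E v w ∧ r w < r v
  opp : ∀ v ∈ A, v ∉ T → owner v ≠ i → ∀ w ∈ S, E v w → w ∈ A ∧ r w < r v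
  compl_own : ∀ v ∈ S, v ∉ A → owner v = i → ∀ w ∈ A, ¬ E v w
  compl_opp : ∀ v ∈ S, v ∉ A → owner v ≠ i → ∃ w ∈ S, w ∉ A ∧ E v w

/-- The positions from which player `i` can force a visit to `T` in at most `n` moves. -/
def attractorStage (owner : V → Fin 2) (E : V → V → Prop) (S T : Set V) (i : Fin 2) : ℕ → Set V
  | 0 => T
  | n + 1 => attractorStage owner E S T i n ∪
      {v | v ∈ S ∧ ((owner v = i ∧ ∃ w ∈ attractorStage owner E S T i n, E v w) ∨
        (owner v ≠ i ∧ ∀ w ∈ S, E v w → w ∈ attractorStage owner E S T i n))}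

/-- The attractor is the union of the stages, and the rank is the first stage containing a position.
Finiteness bounds the stages of all successors of an opponent position at once; without this bound
the union need not be closed under the opponent clause. -/
theorem exists_isAttractor [Finite V] {S T : Set V} (hT : T ⊆ S) (i : Fin 2) :
    ∃ A r, IsAttractor owner E S T i A r := by
  classical
  set st := attractorStage owner E S T i with hst
  have hmono : Monotone st := monotone_nat_of_le_succ fun n => Set.subset_union_left
  have hsub : ∀ n, st n ⊆ S := by
    intro n
    induction n with
    | zero => exact hT
    | succ n ih => exact Set.union_subset ih fun v hv => hv.1
  have key : ∀ v, (∃ n, v ∈ st n) → v ∉ T → ∃ n, sInf {n | v ∈ st n} = n + 1 ∧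
      ((owner v = i ∧ ∃ w ∈ st n, E v w) ∨ (owner v ≠ i ∧ ∀ w ∈ S, E v w → w ∈ st n)) := by
    intro v hv hvT
    have h1 : v ∈ st (sInf {n | v ∈ st n}) := Nat.sInf_mem (s := {n | v ∈ st n}) hv
    rcases h : sInf {n | v ∈ st n} with _ | n
    · rw [h] at h1
      exact absurd h1 hvT
    · rw [h] at h1
      rcases h1 with h1 | h1
      · have : sInf {n | v ∈ st n} ≤ n := Nat.sInf_le h1
        omega
      · exact ⟨n, rfl, h1.2⟩
  have hle : ∀ {n w}, w ∈ st n → sInf {n | w ∈ st n} < n + 1 :=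
    fun h => Nat.lt_succ_of_le (Nat.sInf_le h)
  refine ⟨{v | ∃ n, v ∈ st n}, fun v => sInf {n | v ∈ st n}, fun v hv => ⟨0, hv⟩,
    fun v ⟨n, hn⟩ => hsub n hn, ?_, ?_, ?_, ?_⟩
  · intro v hv hvT ho
    obtain ⟨n, e, ⟨-, w, hw, hE⟩ | h⟩ := key v hv hvT
    · exact ⟨w, ⟨n, hw⟩, hE, e ▸ hle hw⟩
    · exact absurd ho h.1
  · intro v hv hvT ho w hwS hE
    obtain ⟨n, e, h | ⟨-, h⟩⟩ := key v hv hvT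
    · exact absurd h.1 ho
    · exact ⟨⟨n, h w hwS hE⟩, e ▸ hle (h w hwS hE)⟩
  · rintro v hvS hvA ho w ⟨n, hw⟩ hE
    exact hvA ⟨n + 1, Or.inr ⟨hvS, Or.inl ⟨ho, w, hw, hE⟩⟩⟩
  · intro v hvS hvA ho
    by_contra! hcon
    have hall : ∀ w, ∃ n, w ∈ S → E v w → w ∈ st n := by
      intro w
      by_cases hw : w ∈ S ∧ E v w
      · by_contra! h
        refine hcon w hw.1 ?_ hw.2
        rintro ⟨n, hn⟩
        exact (h n).2.2 hn
      · exact ⟨0, fun a b => absurd ⟨a, b⟩ hw⟩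
    choose g hg using hall
    obtain ⟨N, hN⟩ := (Set.finite_range g).bddAbove
    exact hvA ⟨N + 1, Or.inr ⟨hvS, Or.inr ⟨ho, fun w hw hE =>
      hmono (hN ⟨w, rfl⟩) (hg w hw hE)⟩⟩⟩

/-- The rank drops at every step until the target is met: the opponent cannot prevent it, and player
`i` is assumed to play accordingly. -/
theorem IsAttractor.reaches {S T A : Set V} {i : Fin 2} {r : V → ℕ}
    (h : IsAttractor owner E S T i A r) {M : ℕ → V} (hS : ∀ n, M n ∈ S)
    (hE : ∀ n, E (M n) (M (n + 1)))
    (hown : ∀ n, M n ∈ A → M n ∉ T → owner (M n) = i → M (n + 1) ∈ A ∧ r (M (n + 1)) < r (M n))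
    {n : ℕ} (hn : M n ∈ A) : ∃ k ≥ n, M k ∈ T := by
  induction hr : r (M n) using Nat.strong_induction_on generalizing n with
  | _ ρ ih =>
    by_cases hT : M n ∈ T
    · exact ⟨n, le_rfl, hT⟩
    · have hs : M (n + 1) ∈ A ∧ r (M (n + 1)) < r (M n) := by
        by_cases ho : owner (M n) = i
        · exact hown n hn hT ho
        · exact h.opp _ hn hT ho _ (hS _) (hE n)
      obtain ⟨k, hk, hkT⟩ := ih _ (hr ▸ hs.2) hs.1 rfl
      exact ⟨k, by omega, hkT⟩

/-- Removing an attractor creates no dead ends, so the recursion can be applied to the complement.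
-/
theorem IsAttractor.compl_total {S T A : Set V} {i : Fin 2} {r : V → ℕ}
    (h : IsAttractor owner E S T i A r) (hS : ∀ v ∈ S, ∃ w ∈ S, E v w) :
    ∀ v ∈ S \ A, ∃ w ∈ S \ A, E v w := by
  rintro v ⟨hvS, hvA⟩
  by_cases ho : owner v = i
  · obtain ⟨w, hw, hE⟩ := hS v hvS
    exact ⟨w, ⟨hw, fun hwA => h.compl_own v hvS hvA ho w hwA hE⟩, hE⟩
  · obtain ⟨w, hw, hwA, hE⟩ := h.compl_opp v hvS hvA ho
    exact ⟨w, ⟨hw, hwA⟩, hE⟩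

/-- If player `i` wins everywhere outside the attractor of the positions of greatest priority, and
this priority has parity `i`, then player `i` wins everywhere. -/
theorem IsAttractor.winRegion_of_compl {S A W : Set V} {i : Fin 2} {r : V → ℕ} {d : ℕ} {σ : V → V}
    (hA : IsAttractor owner E S {v | v ∈ S ∧ Ω v = d} i A r) (hS : ∀ v ∈ S, ∃ w ∈ S, E v w)
    (hd : d % 2 = (i : ℕ)) (hmax : ∀ v ∈ S, Ω v ≤ d)
    (hW : WinRegion owner E Ω (S \ A) W i σ) (hcov : S \ A ⊆ W) :
    ∃ τ, WinRegion owner E Ω S S i τ := by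
  classical
  -- Outside `A` play `σ`; inside `A` descend in rank until priority `d` is seen, and there move
  -- anywhere within `S`.
  have hmove : ∀ v, ∃ w, v ∈ S → owner v = i → E v w ∧ w ∈ S ∧ (v ∉ A → w = σ v) ∧
      (v ∈ A → Ω v ≠ d → w ∈ A ∧ r w < r v) := by
    intro v
    by_cases h : v ∈ S ∧ owner v = i
    · obtain ⟨hvS, ho⟩ := h
      by_cases hvA : v ∈ A
      · by_cases hvd : Ω v = d
        · obtain ⟨w, hw, hE⟩ := hS v hvS
          exact ⟨w, fun _ _ => ⟨hE, hw, fun h => absurd hvA h, fun _ h => absurd hvd h⟩⟩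
        · obtain ⟨w, hw, hE, hr⟩ := hA.own v hvA (fun h => hvd h.2) ho
          exact ⟨w, fun _ _ => ⟨hE, hA.sub hw, fun h => absurd hvA h, fun _ _ => ⟨hw, hr⟩⟩⟩
      · have := hW.own v (hcov ⟨hvS, hvA⟩) ho
        exact ⟨σ v, fun _ _ => ⟨this.1, (hW.sub this.2).1, fun _ => rfl, fun h => absurd h hvA⟩⟩
    · exact ⟨v, fun h1 h2 => absurd ⟨h1, h2⟩ h⟩
  choose τ hτ using hmove
  refine ⟨τ, subset_rfl, fun v hv ho => ⟨(hτ v hv ho).1, (hτ v hv ho).2.1⟩,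
    fun v _ _ w hw _ => hw, fun M hMS hME hMτ => ?_⟩
  -- Each visit to `A` forces a later visit to the greatest priority `d`. If the visits stop, a tail
  -- of the play lies in `S \ A` and obeys `σ`.
  by_cases hinf : ∃ᶠ n in atTop, M n ∈ A
  · refine ⟨d, hd, ?_, Eventually.of_forall fun n => hmax _ (hMS n)⟩
    rw [frequently_atTop] at hinf ⊢
    intro a
    obtain ⟨n, hn, hnA⟩ := hinf a
    obtain ⟨k, hk, hkT⟩ := hA.reaches hMS hME (fun n h1 h2 ho => by
      have := (hτ _ (hMS n) ho).2.2.2 h1 fun h => h2 ⟨hMS n, h⟩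
      rwa [← hMτ n ho] at this) hnA
    exact ⟨k, by omega, hkT.2⟩
  · rw [not_frequently, eventually_atTop] at hinf
    obtain ⟨a, ha⟩ := hinf
    refine ParityWins.of_tail a (hW.win _ (fun n => hcov ⟨hMS _, ha _ (by omega)⟩) (fun n => ?_)
      fun n ho => ?_)
    · have := hME (n + a)
      rwa [show n + a + 1 = n + 1 + a by omega] at this
    · have := hMτ (n + a) ho
      rw [show n + 1 + a = n + a + 1 by omega, this]
      exact (hτ _ (hMS _) ho).2.2.1 (ha _ (by omega))

/-- The winning region of player `j` in the complement of an attractor of the opponent can be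
extended by its own attractor `B` and by the winning region in the complement of `B`. -/
theorem IsAttractor.winRegion_union {S S' B W' W'' : Set V} {j : Fin 2} {r : V → ℕ} {σ' σ'' : V → V}
    (hesc : ∀ v ∈ S', owner v ≠ j → ∀ w ∈ S, E v w → w ∈ S')
    (hW' : WinRegion owner E Ω S' W' j σ') (hB : IsAttractor owner E S W' j B r)
    (hW'' : WinRegion owner E Ω (S \ B) W'' j σ'') :
    ∃ τ, WinRegion owner E Ω S (W'' ∪ B) j τ := by
  classical
  have hdisj : ∀ v ∈ W'', v ∉ B := fun v hv => (hW''.sub hv).2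
  -- The strategy is assembled from `σ''` on `W''`, `σ'` on `W'` and rank descent on the rest of
  -- `B`; these pieces are disjoint.
  have hmove : ∀ v, ∃ w, v ∈ W'' ∪ B → owner v = j → E v w ∧ w ∈ W'' ∪ B ∧
      (v ∈ W'' → w = σ'' v) ∧ (v ∈ W' → w = σ' v) ∧
      (v ∈ B → v ∉ W' → w ∈ B ∧ r w < r v) := by
    intro v
    by_cases h : v ∈ W'' ∪ B ∧ owner v = j
    · obtain ⟨hv, ho⟩ := h
      rcases hv with hv | hv
      · have := hW''.own v hv ho
        exact ⟨σ'' v, fun _ _ => ⟨this.1, Or.inl this.2, fun _ => rfl,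
          fun h => absurd (hB.target h) (hdisj v hv), fun h => absurd h (hdisj v hv)⟩⟩
      · by_cases hvW : v ∈ W'
        · have := hW'.own v hvW ho
          exact ⟨σ' v, fun _ _ => ⟨this.1, Or.inr (hB.target this.2),
            fun h => absurd hv (hdisj v h), fun _ => rfl, fun _ h => absurd hvW h⟩⟩
        · obtain ⟨w, hw, hE, hr⟩ := hB.own v hv hvW ho
          exact ⟨w, fun _ _ => ⟨hE, Or.inr hw, fun h => absurd hv (hdisj v h),
            fun h => absurd h hvW, fun _ _ => ⟨hw, hr⟩⟩⟩
    · exact ⟨v, fun h1 h2 => absurd ⟨h1, h2⟩ h⟩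
  choose τ hτ using hmove
  have hsub : W'' ∪ B ⊆ S := Set.union_subset (fun v hv => (hW''.sub hv).1) hB.sub
  refine ⟨τ, hsub, fun v hv ho => ⟨(hτ v hv ho).1, (hτ v hv ho).2.1⟩, ?_, ?_⟩
  · rintro v (hv | hv) ho w hw hE
    · by_cases hwB : w ∈ B
      · exact Or.inr hwB
      · exact Or.inl (hW''.opp v hv ho w ⟨hw, hwB⟩ hE)
    · by_cases hvW : v ∈ W'
      · exact Or.inr (hB.target (hW'.opp v hvW ho w (hesc v (hW'.sub hvW) ho w hw hE) hE))
      · exact Or.inr (hB.opp v hv hvW ho w hw hE).1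
  · intro M hM hME hMτ
    -- A play that enters `B` is attracted to `W'` and, since the opponent cannot leave `S'`, stays
    -- there and follows `σ'`. A play that avoids `B` stays in `W''`.
    by_cases hex : ∃ n, M n ∈ B
    · obtain ⟨n, hn⟩ := hex
      obtain ⟨k, -, hk⟩ := hB.reaches (fun n => hsub (hM n)) hME (fun n h1 h2 ho => by
        have := (hτ _ (hM n) ho).2.2.2.2 h1 h2
        rwa [← hMτ n ho] at this) hn
      have hstep : ∀ n, M n ∈ W' → M (n + 1) ∈ W' := by
        intro n hn
        by_cases ho : owner (M n) = j
        · rw [hMτ n ho, (hτ _ (hM n) ho).2.2.2.1 hn]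
          exact (hW'.own _ hn ho).2
        · exact hW'.opp _ hn ho _ (hesc _ (hW'.sub hn) ho _ (hsub (hM _)) (hME n)) (hME n)
      have hall : ∀ n, M (n + k) ∈ W' := by
        intro n
        induction n with
        | zero => simpa using hk
        | succ n ih => rw [show n + 1 + k = n + k + 1 by omega]; exact hstep _ ih
      refine ParityWins.of_tail k (hW'.win _ hall (fun n => ?_) fun n ho => ?_)
      · have := hME (n + k)
        rwa [show n + k + 1 = n + 1 + k by omega] at this
      · rw [show n + 1 + k = n + k + 1 by omega, hMτ _ ho]
        exact (hτ _ (hM _) ho).2.2.2.1 (hall n)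
    · push Not at hex
      have hall : ∀ n, M n ∈ W'' := fun n => (hM n).resolve_right (hex n)
      exact hW''.win M hall hME fun n ho => by
        rw [hMτ n ho]; exact (hτ _ (hM n) ho).2.2.1 (hall n)

/-- Zielonka's recursion. Let `i` have the parity of the greatest priority, and remove the attractor
`A` of `i` to that priority. If the opponent `j` wins nothing in `S \ A`, then `i` wins all of `S`.
Otherwise the region won by `j` there is winning in `S` too; remove its attractor `B` for `j` and
solve `S \ B`. -/
theorem exists_winRegions [Finite V] (S : Set V) :
    (∀ v ∈ S, ∃ w ∈ S, E v w) → ∀ i j : Fin 2, i ≠ j → ∃ Wi Wj σi σj,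
      WinRegion owner E Ω S Wi i σi ∧ WinRegion owner E Ω S Wj j σj ∧ S ⊆ Wi ∪ Wj := by
  classical
  induction S using WellFoundedLT.induction with
  | _ S ih =>
    intro hS
    -- The greatest priority dictates which player takes the first role, so the order of the players
    -- is left open.
    suffices H : ∃ i j : Fin 2, i ≠ j ∧ ∃ Wi Wj σi σj,
        WinRegion owner E Ω S Wi i σi ∧ WinRegion owner E Ω S Wj j σj ∧ S ⊆ Wi ∪ Wj by
      obtain ⟨i, j, hij, Wi, Wj, σi, σj, h1, h2, h3⟩ := H
      intro i' j' hij'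
      have : (i' = i ∧ j' = j) ∨ (i' = j ∧ j' = i) := by omega
      rcases this with ⟨rfl, rfl⟩ | ⟨rfl, rfl⟩
      · exact ⟨_, _, _, _, h1, h2, h3⟩
      · exact ⟨_, _, _, _, h2, h1, Set.union_comm Wi Wj ▸ h3⟩
    rcases S.eq_empty_or_nonempty with rfl | hne
    · exact ⟨0, 1, by decide, ∅, ∅, id, id, .empty _ _ _, .empty _ _ _, by simp⟩
    obtain ⟨v₀, hv₀, hmax⟩ := Set.exists_max_image S Ω S.toFinite hne
    obtain ⟨i, hi⟩ : ∃ i : Fin 2, Ω v₀ % 2 = (i : ℕ) := ⟨⟨Ω v₀ % 2, by omega⟩, rfl⟩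
    obtain ⟨j, hij⟩ : ∃ j : Fin 2, i ≠ j := ⟨i + 1, by omega⟩
    refine ⟨i, j, hij, ?_⟩
    obtain ⟨A, r, hA⟩ := exists_isAttractor (owner := owner) (E := E)
      (T := {v | v ∈ S ∧ Ω v = Ω v₀}) (S := S) (fun v hv => hv.1) i
    have hlt : ∀ {B : Set V} {v}, v ∈ S → v ∈ B → S \ B < S := fun hv hB =>
      Set.ssubset_iff_subset_ne.2 ⟨Set.sdiff_subset, fun e => (e.ge hv).2 hB⟩
    obtain ⟨Wi, Wj, σi, σj, hWi, hWj, hcov⟩ :=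
      ih (S \ A) (hlt hv₀ (hA.target ⟨hv₀, rfl⟩)) (hA.compl_total hS) i j hij
    rcases Wj.eq_empty_or_nonempty with rfl | ⟨u, hu⟩
    · obtain ⟨τ, hτ⟩ := hA.winRegion_of_compl hS hi hmax hWi (by simpa using hcov)
      exact ⟨S, ∅, τ, id, hτ, .empty _ _ _, by simp⟩
    · obtain ⟨B, ρ, hB⟩ := exists_isAttractor (owner := owner) (E := E)
        (T := Wj) (S := S) (fun v hv => (hWj.sub hv).1) j
      obtain ⟨Ui, Uj, τi, τj, hUi, hUj, hcov'⟩ :=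
        ih (S \ B) (hlt (hWj.sub hu).1 (hB.target hu)) (hB.compl_total hS) i j hij
      obtain ⟨τ, hτ⟩ := IsAttractor.winRegion_union (S' := S \ A) (fun v hv ho w hw hE =>
        ⟨hw, fun hwA => hA.compl_own v hv.1 hv.2 (by omega) w hwA hE⟩) hWj hB hUj
      refine ⟨Ui, Uj ∪ B, τi, τ, ⟨fun v hv => (hUi.sub hv).1, hUi.own, ?_, hUi.win⟩, hτ, ?_⟩
      -- From outside its attractor `B`, player `j` has no move into `B`, so the region of `i` in `S
      -- \ B` remains closed in `S`.
      · intro v hv ho w hw hE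
        refine hUi.opp v hv ho w ⟨hw, fun hwB => ?_⟩ hE
        exact hB.compl_own v (hUi.sub hv).1 (hUi.sub hv).2 (by omega) w hwB hE
      · intro v hv
        by_cases hvB : v ∈ B
        · exact Or.inr (Or.inr hvB)
        · rcases hcov' ⟨hv, hvB⟩ with h | h
          · exact Or.inl h
          · exact Or.inr (Or.inl h)

end Zielonka

end FocusTwo

namespace FocusTwo

/-! ### Matches, guided play and determinacy of finite parity games -/

namespace Game

open Filter

variable {G : Game} {pl : Fin 2}

theorem isMatch_singleton (b : G.Board) : G.IsMatch [b] := ⟨by simp, by simp⟩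

theorem isMatch_concat {M : List G.Board} {c : G.Board} (hM : M ≠ []) :
    G.IsMatch (M ++ [c]) ↔ G.IsMatch M ∧ ∀ b ∈ M.getLast?, G.E b c := by
  simp [IsMatch, List.isChain_append, hM]

theorem not_isFull_of_concat {M : List G.Board} {c : G.Board} (hM : M ≠ [])
    (h : G.IsMatch (M ++ [c])) : ¬ G.IsFull M := by
  rintro ⟨-, hf⟩
  have h1 := ((isMatch_concat hM).1 h).2 _ (List.getLast_mem_getLast? hM)
  exact hf _ (List.getLast_mem_getLast? hM) c h1

theorem isPM_of_concat {M : List G.Board} {b c : G.Board} (h : G.IsMatch (M ++ [c]))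
    (hb : M.getLast? = some b) (ho : G.owner b = pl) : G.IsPM pl M := by
  have hM : M ≠ [] := by rintro rfl; simp at hb
  refine ⟨((isMatch_concat hM).1 h).1, not_isFull_of_concat hM h, ?_⟩
  rintro b' hb'
  rw [hb, Option.mem_some_iff] at hb'
  exact hb' ▸ ho

theorem IsPM.exists_move {M : List G.Board} (h : G.IsPM pl M) :
    ∃ b c, M.getLast? = some b ∧ G.owner b = pl ∧ G.E b c := by
  obtain ⟨h1, h2, h3⟩ := h
  simp only [IsFull, h1, true_and, not_forall, not_not] at h2
  obtain ⟨b, hb, c, hc⟩ := h2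
  exact ⟨b, c, hb, h3 b hb, hc⟩

theorem IsInfMatch.isMatch_prefix {M : ℕ → G.Board} (h : G.IsInfMatch M) (n : ℕ) :
    G.IsMatch ((List.range (n + 1)).map M) := by
  induction n with
  | zero => exact isMatch_singleton _
  | succ n ih =>
    rw [List.range_succ, List.map_append]
    refine (isMatch_concat (by simp)).2 ⟨ih, ?_⟩
    simp [List.range_succ, h n]

namespace Strategy

theorem guides_singleton (f : G.Strategy pl) (b : G.Board) : f.Guides [b] := by
  intro M₀ h1 h2
  have := M₀.2.1.1
  obtain ⟨t, ht⟩ := h1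
  rcases h : M₀.1 with _ | ⟨a, l⟩
  · exact absurd h this
  · rw [h] at ht h2
    simp at ht
    simp [ht] at h2

/-- Appending one position adds only `M` itself as a proper prefix to be checked. This makes
guidedness accessible to induction along a match. -/
theorem guides_concat {f : G.Strategy pl} {M : List G.Board} {c : G.Board} :
    f.Guides (M ++ [c]) ↔ f.Guides M ∧ ∀ h : G.IsPM pl M, f ⟨M, h⟩ = c := by
  constructor
  · intro h
    refine ⟨fun M₀ h1 h2 => ?_, fun hM => ?_⟩
    · have h3 := h M₀ (h1.trans (List.prefix_append _ _)) fun e => by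
        have := h1.length_le
        rw [e] at this
        simp at this
      rcases List.prefix_concat_iff.1 h3 with h4 | h4
      · exact absurd (List.append_inj_left' h4 rfl) h2
      · exact h4
    · have h3 := h ⟨M, hM⟩ (List.prefix_append _ _) (by simp)
      simpa using h3
  · rintro ⟨h1, h2⟩ M₀ h3 h4
    rcases List.prefix_concat_iff.1 h3 with h5 | h5
    · exact absurd h5 h4
    · by_cases h6 : M₀.1 = M
      · have hM : G.IsPM pl M := h6 ▸ M₀.2
        have : M₀ = ⟨M, hM⟩ := Subtype.ext h6
        rw [this, h2 hM]
      · exact (h1 M₀ h5 h6).trans (List.prefix_append _ _)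

theorem GuidesInf.guides_prefix {f : G.Strategy pl} {M : ℕ → G.Board} (h : f.GuidesInf M) (n : ℕ) :
    f.Guides ((List.range (n + 1)).map M) := by
  induction n with
  | zero => exact guides_singleton _ _
  | succ n ih =>
    rw [List.range_succ, List.map_append]
    exact guides_concat.2 ⟨ih, fun h' => h n h'⟩

/-- Strategies of the two players cannot both be winning at the same position. -/
theorem not_winningAt_both (f : G.Strategy 0) (g : G.Strategy 1) (q : G.Board)
    (hf : f.WinningAt q) (hg : g.WinningAt q) : False := by
  classical
  -- Both strategies are played against each other. The default `q` never matters, since the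
  -- histories `H n` turn out to be matches that are not full.
  let step : List G.Board → G.Board := fun L =>
    if h : G.IsPM 0 L then f ⟨L, h⟩ else if h : G.IsPM 1 L then g ⟨L, h⟩ else q
  let H : ℕ → List G.Board := fun n => Nat.rec [q] (fun _ L => L ++ [step L]) n
  have Hs : ∀ n, H (n + 1) = H n ++ [step (H n)] := fun n => rfl
  let a : ℕ → G.Board := fun n => (H n).getLast?.getD q
  have Ha : ∀ n, H n = (List.range (n + 1)).map a := by
    intro n
    induction n with
    | zero => rfl
    | succ n ih =>
      rw [List.range_succ, List.map_append, ← ih]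
      simp [a, Hs]
  have hhead : ∀ n, (H n).head? = some q := by
    intro n
    rw [Ha, List.range_succ_eq_map]
    rfl
  have hne : ∀ n, H n ≠ [] := fun n h => by simpa [h] using hhead n
  have hlast : ∀ n, (H n).getLast? = some (a n) := fun n => by
    rw [Ha, List.range_succ]; simp
  have hinv : ∀ n, G.IsMatch (H n) ∧ f.Guides (H n) ∧ g.Guides (H n) ∧ ¬ G.IsFull (H n) := by
    intro n
    have key : G.IsMatch (H n) ∧ f.Guides (H n) ∧ g.Guides (H n) := by
      induction n with
      | zero => exact ⟨isMatch_singleton _, guides_singleton _ _, guides_singleton _ _⟩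
      | succ n ih =>
        obtain ⟨h1, h2, h3⟩ := ih
        -- The last position of a full match guided by both strategies could belong to neither
        -- player.
        have h4 : ¬ G.IsFull (H n) := fun h => by
          have e1 := hf.fin _ h (hhead n) h2 _ (hlast n)
          have e2 := hg.fin _ h (hhead n) h3 _ (hlast n)
          omega
        rw [Hs]
        have e0 : ∀ h : G.IsPM 0 (H n), f ⟨_, h⟩ = step (H n) := fun h => by simp [step, h]
        have e1 : ∀ h : G.IsPM 1 (H n), g ⟨_, h⟩ = step (H n) := fun h => by
          have : ¬ G.IsPM 0 (H n) := fun h' => by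
            have := (h.2.2 _ (hlast n)).symm.trans (h'.2.2 _ (hlast n))
            exact absurd this (by decide)
          simp [step, h, this]
        refine ⟨(isMatch_concat (hne n)).2 ⟨h1, fun b hb => ?_⟩, guides_concat.2 ⟨h2, e0⟩,
          guides_concat.2 ⟨h3, e1⟩⟩
        have hpm : G.IsPM (G.owner b) (H n) := ⟨h1, h4, fun b' hb' => by
          rw [Option.mem_unique hb hb']⟩
        have : G.owner b = 0 ∨ G.owner b = 1 := by omega
        rcases this with h | h <;> rw [h] at hpm
        · exact e0 hpm ▸ hf.surviving ⟨_, hpm⟩ (hhead n) b hb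
        · exact e1 hpm ▸ hg.surviving ⟨_, hpm⟩ (hhead n) b hb
    refine ⟨key.1, key.2.1, key.2.2, fun h => ?_⟩
    have e1 := hf.fin _ h (hhead n) key.2.1 _ (hlast n)
    have e2 := hg.fin _ h (hhead n) key.2.2 _ (hlast n)
    omega
  have hconc : ∀ n, H (n + 1) = H n ++ [a (n + 1)] := fun n => by
    rw [Ha (n + 1), List.range_succ, List.map_append, ← Ha]; rfl
  have hM : G.IsInfMatch a := fun n =>
    ((isMatch_concat (hne n)).1 (hconc n ▸ (hinv (n + 1)).1)).2 _ (hlast n)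
  have hfM : f.GuidesInf a := fun n => by
    rw [← Ha]
    exact (guides_concat.1 (hconc n ▸ (hinv (n + 1)).2.1)).2
  have hgM : g.GuidesInf a := fun n => by
    rw [← Ha]
    exact (guides_concat.1 (hconc n ▸ (hinv (n + 1)).2.2.1)).2
  have e := (hf.inf a hM rfl hfM).symm.trans (hg.inf a hM rfl hgM)
  exact absurd e (by decide)

/-- The positional strategy given by a map on positions. -/
def ofMap (pl : Fin 2) (τ : G.Board → G.Board) : G.Strategy pl :=
  fun M => τ (M.1.getLast M.2.1.1)

theorem ofMap_apply {τ : G.Board → G.Board} (M : {M : List G.Board // G.IsPM pl M}) {b : G.Board}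
    (hb : M.1.getLast? = some b) : ofMap pl τ M = τ b := by
  have := List.getLast?_eq_some_getLast M.2.1.1
  rw [this, Option.some_inj] at hb
  rw [ofMap, hb]

theorem ofMap_positional (pl : Fin 2) (τ : G.Board → G.Board) : (ofMap pl τ).Positional := by
  intro M M' h
  have h1 := List.getLast?_eq_some_getLast M.2.1.1
  rw [ofMap_apply M h1, ofMap_apply M' (h.symm.trans h1)]

end Strategy

/-- Finite parity games are positionally determined. -/
theorem IsParity.positionallyDetermined [Finite G.Board] {Ω : G.Board → ℕ} (h : G.IsParity Ω) :
    G.PositionallyDetermined := by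
  classical
  -- `exists_winRegions` needs a total move relation, so dead ends receive a loop. Their priority `1
  -- - owner` makes the stuck owner lose the looping play.
  let E' : G.Board → G.Board → Prop := fun v w => G.E v w ∨ ((∀ c, ¬ G.E v c) ∧ w = v)
  let Ω' : G.Board → ℕ := fun v => if ∀ c, ¬ G.E v c then 1 - (G.owner v : ℕ) else Ω v
  obtain ⟨W₀, W₁, σ₀, σ₁, h0, h1, hcov⟩ := exists_winRegions (owner := G.owner) (E := E') (Ω := Ω')
    Set.univ (fun v _ => by
      by_cases hv : ∀ c, ¬ G.E v c
      · exact ⟨v, trivial, Or.inr ⟨hv, rfl⟩⟩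
      · push Not at hv
        obtain ⟨c, hc⟩ := hv
        exact ⟨c, trivial, Or.inl hc⟩) 0 1 (by decide)
  have hmove : ∀ v, ∃ w, (∃ c, G.E v c) → G.E v w := fun v => by
    by_cases hv : ∃ c, G.E v c
    · exact ⟨hv.choose, fun _ => hv.choose_spec⟩
    · exact ⟨v, fun h => absurd h hv⟩
  choose any hany using hmove
  have main : ∀ (pl : Fin 2) (W : Set G.Board) (σ : G.Board → G.Board),
      WinRegion G.owner E' Ω' Set.univ W pl σ → ∃ f : G.Strategy pl, f.Positional ∧
        ∀ q ∈ W, f.WinningAt q := by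
    intro pl W σ hW
    -- Survival concerns all matches from `q`, also unguided ones that leave `W`, so an admissible
    -- move is supplied there as well.
    let τ : G.Board → G.Board := fun v => if v ∈ W then σ v else any v
    have hτ : ∀ {v}, v ∈ W → τ v = σ v := fun hv => if_pos hv
    have hstay : ∀ {M : List G.Board}, G.IsMatch M → (Strategy.ofMap pl τ).Guides M →
        ∀ q ∈ W, M.head? = some q → ∀ b ∈ M.getLast?, b ∈ W := by
      intro M hM hg q hq hh b hb
      induction M using List.reverseRecOn generalizing b with
      | nil => simp at hb
      | append_singleton M c ih =>
        simp only [List.getLast?_append, List.getLast?_singleton, Option.some_or,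
          Option.mem_some_iff] at hb
        subst hb
        rcases M.eq_nil_or_concat with rfl | ⟨M', b, rfl⟩
        · simp at hh
          exact hh ▸ hq
        · have hne : M'.concat b ≠ [] := by simp
          have hlast : (M'.concat b).getLast? = some b := by simp
          obtain ⟨hm, hE⟩ := (isMatch_concat hne).1 hM
          obtain ⟨hg1, hg2⟩ := Strategy.guides_concat.1 hg
          have hbW := ih hm hg1 (by rwa [List.head?_append_of_ne_nil _ hne] at hh) b hlast
          by_cases ho : G.owner b = pl
          · have := hg2 (isPM_of_concat hM hlast ho)
            rw [Strategy.ofMap_apply _ hlast, hτ hbW] at this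
            exact this ▸ (hW.own b hbW ho).2
          · exact hW.opp b hbW ho c trivial (Or.inl (hE b hlast))
    refine ⟨.ofMap pl τ, Strategy.ofMap_positional _ _, fun q hq => ⟨?_, ?_, ?_⟩⟩
    · intro M _ b hb
      obtain ⟨b', c, hb', ho, hE⟩ := M.2.exists_move
      obtain rfl := Option.mem_unique hb hb'
      rw [Strategy.ofMap_apply _ hb]
      by_cases hbW : b ∈ W
      · rw [hτ hbW]
        exact (hW.own b hbW ho).1.resolve_right fun h => h.1 c hE
      · rw [show τ b = any b from if_neg hbW]
        exact hany b ⟨c, hE⟩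
    · intro M hM hh hg b hb ho
      have hbW := hstay hM.1 hg q hq hh b hb
      have hdead := hM.2 b hb
      -- At a dead end of `pl` inside `W` the strategy could only loop, and the constant play would
      -- be won by `pl` although its priority has the other parity.
      have hσ : b = σ b := ((hW.own b hbW ho).1.resolve_left (hdead _)).2.symm
      obtain ⟨m, hm, hm', -⟩ := hW.win (fun _ => b) (fun _ => hbW) (fun _ => Or.inr ⟨hdead, rfl⟩)
        fun _ _ => hσ
      obtain ⟨_, e⟩ := hm'.exists
      have : Ω' b = 1 - (G.owner b : ℕ) := if_pos hdead
      dsimp only at e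
      rw [this, ho] at e
      omega
    · intro M hM hM0 hg
      have hMW : ∀ n, M n ∈ W := fun n => hstay (hM.isMatch_prefix n) (hg.guides_prefix n) q hq
        (by rw [List.range_succ_eq_map]; simp [hM0]) _ (by simp [List.range_succ])
      obtain ⟨m, hm, hm1, hm2⟩ := hW.win M hMW (fun n => Or.inl (hM n)) fun n ho => by
        have hpm : G.IsPM pl ((List.range (n + 1)).map M) :=
          isPM_of_concat (b := M n) (c := M (n + 1))
            (by simpa [List.range_succ] using hM.isMatch_prefix (n + 1))
            (by simp [List.range_succ]) ho
        rw [← hg n hpm, Strategy.ofMap_apply (b := M n) _ (by simp [List.range_succ]), hτ (hMW n)]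
      have hΩ : ∀ n, Ω' (M n) = Ω (M n) := fun n => if_neg fun h => h _ (hM n)
      simp only [hΩ] at hm1 hm2
      obtain ⟨m', ⟨hm'1, hm'2⟩, hWm⟩ := h.2 M hM
      have e1 : m ≤ m' := hm'2 hm1
      have e2 : m' ≤ m := by
        obtain ⟨n, hn1, hn2⟩ := (Frequently.and_eventually hm'1 hm2).exists
        exact hn1 ▸ hn2
      apply Fin.ext
      rw [hWm, ← hm, le_antisymm e1 e2]
  obtain ⟨f₀, hf₀, hf₀'⟩ := main 0 W₀ σ₀ h0
  obtain ⟨f₁, hf₁, hf₁'⟩ := main 1 W₁ σ₁ h1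
  refine ⟨fun pl => match pl with
    | 0 => f₀
    | 1 => f₁, fun pl => ?_, fun q => ?_⟩
  · match pl with
    | 0 => exact hf₀
    | 1 => exact hf₁
  · rcases hcov (Set.mem_univ q) with hq | hq
    · exact ⟨0, hf₀' q hq⟩
    · exact ⟨1, hf₁' q hq⟩

end Game

end FocusTwo

namespace FocusTwo

/-! ### The proof search game is a finite parity game -/

section SearchGame

open Filter

variable {P D : Type*} [TwoWayActions D] {Sig : Finset (Formula P D)}

theorem finite_itemOver {P D : Type*} (Sig : Finset (Formula P D)) : {A : Item P D | A.Over Sig}.Finite := by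
  have hS : (Sig : Set (Formula P D)).Finite := Sig.finite_toSet
  have hA : (Set.univ : Set Ann).Finite :=
    (Set.toFinite {Ann.u, Ann.f}).subset fun b _ => by cases b <;> simp
  refine (((hS.prod hA).image fun x => Item.ann x.1 x.2).union
    (((hS.prod hS).image fun x => Item.tr x.1 x.2).union
      ((hS.prod hS).image fun x => Item.ntr x.1 x.2))).subset fun A h => ?_
  cases A with
  | ann φ b => exact Or.inl ⟨(φ, b), ⟨h, trivial⟩, rfl⟩
  | tr φ ψ => exact Or.inr (Or.inl ⟨(φ, ψ), h, rfl⟩)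
  | ntr φ ψ => exact Or.inr (Or.inr ⟨(φ, ψ), h, rfl⟩)

instance finite_seqOver {P D : Type*} {Sig : Finset (Formula P D)} : Finite (SeqOver Sig) := by
  classical
  refine Set.Finite.to_subtype (s := {Γ : Sequent P D | Γ.Over Sig})
    ((finite_itemOver Sig).toFinset.powerset.finite_toSet.subset fun Γ h => ?_)
  simp only [Finset.coe_powerset, Set.Finite.coe_toFinset, Set.mem_preimage, Set.mem_powerset_iff]
  exact fun A hA => h A hA

theorem RuleApp.length_le {Γ : Sequent P D} {r : Rule D} {Δs : List (Sequent P D)}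
    (h : RuleApp Sig Γ r Δs) : Δs.length ≤ 2 := by
  cases h <;> simp

theorem RuleApp.isAxiom {Γ : Sequent P D} {r : Rule D} (h : RuleApp Sig Γ r []) : r.IsAxiom := by
  cases h <;> simp [Rule.IsAxiom]

/-- There are infinitely many actions, but the principal formula of a modal instance lies in `Sig`
and reveals its action. -/
theorem finite_range_rule : (Set.range (InstOver.rule (Sig := Sig))).Finite := by
  let g : Formula P D → Rule D := fun φ => match φ with
    | .box a _ => .box a
    | _ => .ax1
  refine ((Set.toFinite {.ax1, .ax2, .ax3, .or, .and, .mu, .nu, .cut, .foc, .trans, .tc}).union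
    (Sig.finite_toSet.image g)).subset ?_
  rintro _ ⟨⟨⟨Γ, hΓ⟩, r, Δs, h⟩, rfl⟩
  dsimp only at h ⊢
  generalize Δs.map Subtype.val = Ξ at h
  cases h
  case box a φ b Γ' => exact Or.inr ⟨.box a φ, hΓ (.ann (.box a φ) b) (by simp), rfl⟩
  all_goals simp

instance finite_instOver : Finite (InstOver Sig) := by
  have h1 := (finite_range_rule (Sig := Sig)).to_subtype
  have h2 : Finite {l : List (SeqOver Sig) // l.length ≤ 2} :=
    (List.finite_length_le (SeqOver Sig) 2).to_subtype
  let g : InstOver Sig → SeqOver Sig × Set.range (InstOver.rule (Sig := Sig)) ×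
      {l : List (SeqOver Sig) // l.length ≤ 2} :=
    fun i => (i.conc, ⟨i.rule, i, rfl⟩, ⟨i.prem, List.length_map (as := i.prem) Subtype.val ▸ i.valid.length_le⟩)
  refine Finite.of_injective g ?_
  rintro ⟨c, r, p, v⟩ ⟨c', r', p', v'⟩ h
  simp only [g, Prod.mk.injEq] at h
  obtain ⟨rfl, h1, h2⟩ := h
  obtain rfl : r = r' := congrArg Subtype.val h1
  obtain rfl : p = p' := congrArg Subtype.val h2
  rfl

instance finite_board : Finite (searchGame Sig).Board :=
  inferInstanceAs (Finite (SeqOver Sig ⊕ InstOver Sig))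

/-- Every sequent is the conclusion of a rule instance. -/
theorem exists_inst (hSig : NegationClosed Sig) (Γ : SeqOver Sig) :
    ∃ i : InstOver Sig, i.conc = Γ := by
  -- A cut on any formula of `Sig` is always available. If there is none, the only sequent is empty
  -- and the focus rule applies to it.
  rcases Sig.eq_empty_or_nonempty with rfl | ⟨φ, hφ⟩
  · obtain ⟨Γ, hΓ⟩ := Γ
    have : Γ = ∅ := Finset.eq_empty_of_forall_notMem fun A hA => by
      have := hΓ A hA
      cases A <;> simp [Item.Over] at this
    subst this
    exact ⟨⟨_, .foc, [⟨∅, hΓ⟩], RuleApp.foc ∅⟩, rfl⟩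
  · have hover : ∀ A : Item P D, A.Over Sig → Sequent.Over Sig ({A} ∪ Γ.1) := by
      intro A hA B hB
      rcases Finset.mem_union.1 hB with hB | hB
      · rw [Finset.mem_singleton.1 hB]
        exact hA
      · exact Γ.2 B hB
    exact ⟨⟨Γ, .cut, [⟨_, hover (.ann φ .u) hφ⟩, ⟨_, hover (.ann φ.neg .u) (hSig φ hφ).1⟩],
      RuleApp.cut φ Γ.1⟩, rfl⟩

theorem searchMove_inl {Γ : SeqOver Sig} {b : SeqOver Sig ⊕ InstOver Sig}
    (h : searchMove Sig (.inl Γ) b) : ∃ i, b = .inr i ∧ i.conc = Γ := by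
  cases b with
  | inl Δ => exact h.elim
  | inr i => exact ⟨i, rfl, h⟩

theorem searchMove_inr {i : InstOver Sig} {b : SeqOver Sig ⊕ InstOver Sig}
    (h : searchMove Sig (.inr i) b) : ∃ Δ, b = .inl Δ ∧ Δ ∈ i.prem := by
  cases b with
  | inl Δ => exact ⟨Δ, rfl, h⟩
  | inr i => exact h.elim

theorem searchGame_W_eq_zero {M : ℕ → SeqOver Sig ⊕ InstOver Sig} (h : ProverCondition Sig M) :
    (searchGame Sig).W M = 0 :=
  if_pos h

theorem searchGame_W_eq_one {M : ℕ → SeqOver Sig ⊕ InstOver Sig} (h : ¬ ProverCondition Sig M) :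
    (searchGame Sig).W M = 1 :=
  if_neg h

theorem searchPriority_le (b : SeqOver Sig ⊕ InstOver Sig) : searchPriority Sig b ≤ 3 := by
  rcases b with Γ | i
  · simp [searchPriority]
  · simp only [searchPriority]
    split_ifs <;> simp

theorem searchPriority_eq_three {b : SeqOver Sig ⊕ InstOver Sig} :
    searchPriority Sig b = 3 ↔ ∃ i, b = .inr i ∧ ¬ i.conc.1.HasFocus := by
  rcases b with Γ | i
  · simp [searchPriority]
  · simp only [searchPriority, Sum.inr.injEq, exists_eq_left']
    split_ifs <;> simp_all

theorem searchPriority_eq_two {b : SeqOver Sig ⊕ InstOver Sig} :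
    searchPriority Sig b = 2 ↔ ∃ i, b = .inr i ∧ i.conc.1.HasFocus ∧ i.rule.IsModal := by
  rcases b with Γ | i
  · simp [searchPriority]
  · simp only [searchPriority, Sum.inr.injEq, exists_eq_left']
    split_ifs <;> simp_all

theorem searchPriority_eq_zero {b : SeqOver Sig ⊕ InstOver Sig} :
    searchPriority Sig b = 0 ↔ ∃ Γ, b = .inl Γ := by
  rcases b with Γ | i
  · simp [searchPriority]
  · simp only [searchPriority]
    split_ifs <;> simp

/-- Prover's winning condition in terms of the priorities. -/
theorem proverCondition_iff {M : ℕ → SeqOver Sig ⊕ InstOver Sig} (hM : (searchGame Sig).IsInfMatch M) :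
    ProverCondition Sig M ↔ (∀ᶠ n in atTop, searchPriority Sig (M n) ≠ 3) ∧
      ∃ᶠ n in atTop, searchPriority Sig (M n) = 2 := by
  have hfoc : (∃ N, ∀ n ≥ N, ∀ Γ : SeqOver Sig, M n = .inl Γ → Γ.1.HasFocus) ↔
      ∀ᶠ n in atTop, searchPriority Sig (M n) ≠ 3 := by
    rw [eventually_atTop]
    constructor
    · rintro ⟨N, hN⟩
      -- The shift by one leaves room for the sequent preceding the instance at `n`, which is its
      -- conclusion.
      refine ⟨N + 1, fun n hn h3 => ?_⟩
      obtain ⟨i, hi, hf⟩ := searchPriority_eq_three.1 h3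
      obtain ⟨n, rfl⟩ : ∃ m, n = m + 1 := ⟨n - 1, by omega⟩
      have hE := hM n
      rw [hi] at hE
      rcases h : M n with Γ | j
      · rw [h] at hE
        have e : i.conc = Γ := hE
        exact hf (e ▸ hN n (by omega) Γ h)
      · rw [h] at hE
        exact hE
    · rintro ⟨N, hN⟩
      refine ⟨N, fun n hn Γ hΓ => ?_⟩
      have hE := hM n
      rw [hΓ] at hE
      obtain ⟨i, hi, e⟩ := searchMove_inl hE
      by_contra hf
      exact hN (n + 1) (by omega) (searchPriority_eq_three.2 ⟨i, hi, e ▸ hf⟩)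
  refine (and_congr_left' hfoc).trans (and_congr_right fun h3 => ⟨fun h => (h.and_eventually h3).mono ?_, fun h => h.mono ?_⟩)
  · rintro n ⟨⟨i, hi, hm⟩, hn⟩
    refine searchPriority_eq_two.2 ⟨i, hi, ?_, hm⟩
    by_contra hf
    exact hn (searchPriority_eq_three.2 ⟨i, hi, hf⟩)
  · intro n hn
    obtain ⟨i, hi, -, hm⟩ := searchPriority_eq_two.1 hn
    exact ⟨i, hi, hm⟩

/-- By `proverCondition_iff`, Prover wins exactly if 3 occurs finitely often and 2 infinitely often.
Otherwise the greatest recurring priority is 3 or 1; it is never 0, since instances recur. -/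
theorem searchGame_isParity (Sig : Finset (Formula P D)) :
    (searchGame Sig).IsParity (searchPriority Sig) := by
  refine ⟨(Set.finite_Iic 3).subset ?_, fun M hM => ?_⟩
  · rintro _ ⟨b, rfl⟩
    exact searchPriority_le b
  have hle : ∀ k, (∃ᶠ n in atTop, searchPriority Sig (M n) = k) → k ≤ 3 := fun k hk => by
    obtain ⟨n, hn⟩ := hk.exists
    exact hn ▸ searchPriority_le _
  by_cases h3 : ∃ᶠ n in atTop, searchPriority Sig (M n) = 3
  · refine ⟨3, ⟨h3, hle⟩, ?_⟩
    rw [searchGame_W_eq_one fun h => h3 ((proverCondition_iff hM).1 h).1]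
    rfl
  have h3' : ∀ᶠ n in atTop, searchPriority Sig (M n) ≠ 3 := not_frequently.1 h3
  by_cases h2 : ∃ᶠ n in atTop, searchPriority Sig (M n) = 2
  · refine ⟨2, ⟨h2, fun k hk => ?_⟩, ?_⟩
    · have := hle k hk
      have : k ≠ 3 := fun e => h3 (e ▸ hk)
      omega
    · rw [searchGame_W_eq_zero ((proverCondition_iff hM).2 ⟨h3', h2⟩)]
      rfl
  have h2' : ∀ᶠ n in atTop, searchPriority Sig (M n) ≠ 2 := not_frequently.1 h2
  refine ⟨1, ⟨?_, fun k hk => ?_⟩, ?_⟩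
  -- From `N` on every instance has priority 1, and one of any two consecutive positions is an
  -- instance.
  · obtain ⟨N, hN⟩ := eventually_atTop.1 (h3'.and h2')
    have hinst : ∀ n ≥ N, (∃ i, M n = .inr i) → searchPriority Sig (M n) = 1 := by
      rintro n hn ⟨i, hi⟩
      have h1 := searchPriority_le (M n)
      have h0 : searchPriority Sig (M n) ≠ 0 := fun h => by
        obtain ⟨Γ, hΓ⟩ := searchPriority_eq_zero.1 h
        rw [hi] at hΓ
        cases hΓ
      have := hN n hn
      omega
    refine frequently_atTop.2 fun a => ?_
    rcases h : M (max a N) with Γ | i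
    · have hE := hM (max a N)
      rw [h] at hE
      obtain ⟨i, hi, -⟩ := searchMove_inl hE
      exact ⟨_, by omega, hinst _ (by omega) ⟨i, hi⟩⟩
    · exact ⟨_, le_max_left _ _, hinst _ (le_max_right _ _) ⟨i, h⟩⟩
  · have := hle k hk
    have : k ≠ 3 := fun e => h3 (e ▸ hk)
    have : k ≠ 2 := fun e => h2 (e ▸ hk)
    omega
  · rw [searchGame_W_eq_one fun h => h2 ((proverCondition_iff hM).1 h).2]
    rfl

end SearchGame

end FocusTwo

namespace FocusTwo

section Trees

open Filter Game

variable {P D : Type*} [TwoWayActions D] {Sig : Finset (Formula P D)}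

/-- The position of the game given by a rule instance. -/
abbrev instPos (i : InstOver Sig) : (searchGame Sig).Board := Sum.inr i

/-! ### Histories in derivation trees -/

namespace DerivTree

variable {π : DerivTree Sig} {p : List ℕ} {k : ℕ} {i : InstOver Sig} {n : Node Sig}
  {Γ : SeqOver Sig}

theorem Concludes.exists_label (h : π.Concludes Γ) : ∃ n, π.label [] = some n ∧ n.conc = Γ :=
  Option.map_eq_some_iff.1 h

theorem exists_of_label_concat (h : π.label (p ++ [k]) = some n) :
    ∃ i, π.label p = some (.app i) ∧ i.prem[k]? = some n.conc := by
  have hc := π.child p k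
  rw [h, Option.map_some, eq_comm, Option.bind_eq_some_iff] at hc
  obtain ⟨m, hm, he⟩ := hc
  cases m with
  | opn Γ => simp [Node.prem] at he
  | app i => exact ⟨i, hm, he⟩

theorem exists_label_concat {Δ : SeqOver Sig} (h : π.label p = some (.app i))
    (hk : i.prem[k]? = some Δ) : ∃ n, π.label (p ++ [k]) = some n ∧ n.conc = Δ := by
  have hc := π.child p k
  rw [h, Option.bind_some] at hc
  exact Option.map_eq_some_iff.1 (hc.trans hk)

theorem matchTo_nil (h : π.label [] = some n) : π.matchTo [] = [seqPos n.conc] := by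
  simp [matchTo, h]

theorem matchTo_concat (h : π.label p = some (.app i)) (h' : π.label (p ++ [k]) = some n) :
    π.matchTo (p ++ [k]) = π.matchTo p ++ [instPos i] ++ [seqPos n.conc] := by
  have e : ((List.range p.length).flatMap fun j =>
      ((π.label ((p ++ [k]).take j)).map Node.moves).getD []) =
      (List.range p.length).flatMap fun j => ((π.label (p.take j)).map Node.moves).getD [] := by
    refine List.flatMap_congr fun j hj => ?_
    rw [List.take_append_of_le_length (List.mem_range.1 hj).le]
  unfold matchTo
  rw [List.length_append, List.length_singleton, List.range_succ,
    List.flatMap_append, e, h, h']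
  simp only [h, List.flatMap_singleton, List.take_left, Option.map_some, Option.toList_some,
    Option.getD_some, Node.moves, List.append_assoc]
  rfl

theorem isMatch_matchTo (h : π.label p = some n) :
    (searchGame Sig).IsMatch (π.matchTo p) ∧ (π.matchTo p).getLast? = some (seqPos n.conc) := by
  induction p using List.reverseRecOn generalizing n with
  | nil =>
    rw [matchTo_nil h]
    exact ⟨isMatch_singleton _, rfl⟩
  | append_singleton p k ih =>
    obtain ⟨i, hi, hk⟩ := exists_of_label_concat h
    obtain ⟨h1, h2⟩ := ih hi
    have hne : π.matchTo p ≠ [] := h1.1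
    rw [matchTo_concat hi h]
    refine ⟨(isMatch_concat (by simp)).2 ⟨(isMatch_concat hne).2 ⟨h1, ?_⟩, ?_⟩, by simp⟩
    · intro b hb
      obtain rfl := Option.mem_unique hb h2
      exact (rfl : i.conc = i.conc)
    · intro b hb
      obtain rfl : instPos i = b := by simpa using hb
      exact (List.mem_of_getElem? hk : n.conc ∈ i.prem)

theorem head?_matchTo (hΓ : π.Concludes Γ) (h : π.label p = some n) :
    (π.matchTo p).head? = some (seqPos Γ) := by
  induction p using List.reverseRecOn generalizing n with
  | nil =>
    obtain ⟨m, hm, e⟩ := hΓ.exists_label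
    rw [matchTo_nil hm, e]
    rfl
  | append_singleton p k ih =>
    obtain ⟨i, hi, hk⟩ := exists_of_label_concat h
    rw [matchTo_concat hi h, List.append_assoc,
      List.head?_append_of_ne_nil _ (isMatch_matchTo hi).1.1, ih hi]

theorem length_matchTo (h : π.label p = some n) : (π.matchTo p).length = 2 * p.length + 1 := by
  induction p using List.reverseRecOn generalizing n with
  | nil => simp [matchTo_nil h]
  | append_singleton p k ih =>
    obtain ⟨i, hi, hk⟩ := exists_of_label_concat h
    rw [matchTo_concat hi h]
    simp only [List.length_append, List.length_singleton, ih hi]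
    omega

theorem isPM_matchTo (hSig : NegationClosed Sig) (h : π.label p = some n) :
    (searchGame Sig).IsPM 0 (π.matchTo p) := by
  obtain ⟨h1, h2⟩ := isMatch_matchTo h
  refine ⟨h1, fun hf => ?_, fun b hb => ?_⟩
  · obtain ⟨i, hi⟩ := exists_inst hSig n.conc
    exact hf.2 _ h2 (.inr i) hi
  · obtain rfl := Option.mem_unique hb h2
    rfl

theorem IsProof.exists_app (hπ : π.IsProof) (h : π.label p = some n) : ∃ i, n = .app i := by
  cases n with
  | opn Γ =>
    obtain ⟨i, hi, -⟩ := hπ.leaf p _ h rfl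
    exact ⟨i, hi⟩
  | app i => exact ⟨i, rfl⟩

/-- The infinite match `M` runs along the branch `x`. -/
def Tracks (π : DerivTree Sig) (x : ℕ → ℕ) (M : ℕ → (searchGame Sig).Board) : Prop :=
  ∀ k, ∃ i, π.label ((List.range k).map x) = some (.app i) ∧ M (2 * k) = seqPos i.conc ∧
    M (2 * k + 1) = Sum.inr i

theorem Tracks.isBranch {x : ℕ → ℕ} {M : ℕ → (searchGame Sig).Board} (h : π.Tracks x M) :
    π.IsBranch x := fun k => by
  obtain ⟨i, hi, -⟩ := h k
  simp [hi]

theorem Tracks.matchTo {x : ℕ → ℕ} {M : ℕ → (searchGame Sig).Board} (h : π.Tracks x M) (k : ℕ) :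
    π.matchTo ((List.range k).map x) = (List.range (2 * k + 1)).map M := by
  induction k with
  | zero =>
    obtain ⟨i, hi, h0, -⟩ := h 0
    rw [List.range_zero, List.map_nil] at hi ⊢
    rw [matchTo_nil hi]
    simp only [Nat.mul_zero, Nat.zero_add, List.range_one, List.map_singleton] at h0 ⊢
    rw [h0]
    rfl
  | succ k ih =>
    obtain ⟨i, hi, h0, h1⟩ := h k
    obtain ⟨j, hj, h2, -⟩ := h (k + 1)
    rw [List.range_succ, List.map_append] at hj ⊢
    rw [List.map_singleton] at hj ⊢
    rw [matchTo_concat hi hj, ih, show 2 * (k + 1) + 1 = 2 * k + 1 + 1 + 1 by ring,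
      List.range_succ (n := 2 * k + 1 + 1), List.range_succ (n := 2 * k + 1), List.map_append,
      List.map_append, List.map_singleton, List.map_singleton, h1]
    rw [show 2 * (k + 1) = 2 * k + 1 + 1 by ring] at h2
    rw [h2]
    rfl

/-- Sequents sit at the even positions and instances at the odd ones, so both conditions translate
by halving and doubling indices. -/
theorem Tracks.proverCondition_iff {x : ℕ → ℕ} {M : ℕ → (searchGame Sig).Board}
    (h : π.Tracks x M) : ProverCondition Sig M ↔
      (∀ᶠ k in atTop, ∀ n, π.label ((List.range k).map x) = some n → n.conc.1.HasFocus) ∧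
      ∃ᶠ k in atTop, ∃ i : InstOver Sig,
        π.label ((List.range k).map x) = some (.app i) ∧ i.rule.IsModal := by
  refine and_congr ?_ ?_
  · rw [eventually_atTop]
    constructor
    · rintro ⟨N, hN⟩
      refine ⟨N, fun k hk n hn => ?_⟩
      obtain ⟨i, hi, h0, -⟩ := h k
      rw [hi, Option.some_inj] at hn
      exact hn ▸ hN (2 * k) (by omega) _ h0
    · rintro ⟨N, hN⟩
      refine ⟨2 * N, fun n hn Γ hΓ => ?_⟩
      obtain ⟨i, hi, h0, h1⟩ := h (n / 2)
      rcases Nat.mod_two_eq_zero_or_one n with hm | hm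
      · rw [show 2 * (n / 2) = n by omega, hΓ] at h0
        obtain rfl : Γ = i.conc := Sum.inl_injective h0
        exact hN (n / 2) (by omega) _ hi
      · rw [show 2 * (n / 2) + 1 = n by omega, hΓ] at h1
        cases h1
  · rw [frequently_atTop, frequently_atTop]
    constructor
    · intro hf a
      obtain ⟨n, hn, i, hi, hr⟩ := hf (2 * a)
      obtain ⟨j, hj, h0, h1⟩ := h (n / 2)
      refine ⟨n / 2, by omega, j, hj, ?_⟩
      rcases Nat.mod_two_eq_zero_or_one n with hm | hm
      · rw [show 2 * (n / 2) = n by omega, hi] at h0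
        cases h0
      · rw [show 2 * (n / 2) + 1 = n by omega, hi] at h1
        exact Sum.inr_injective h1 ▸ hr
    · intro hf a
      obtain ⟨k, hk, i, hi, hr⟩ := hf a
      obtain ⟨j, hj, -, h1⟩ := h k
      rw [hi, Option.some_inj] at hj
      cases hj
      exact ⟨2 * k + 1, by omega, i, h1, hr⟩

/-! ### Strategies that play inside a tree -/

/-- At the nodes in `K`, the strategy `f` chooses the rule instance that is applied in `π`. -/
def Follows (f : ProverStrategy Sig) (π : DerivTree Sig) (K : Set (List ℕ)) : Prop :=
  ∀ p ∈ K, ∀ n, π.label p = some n → ∀ h : (searchGame Sig).IsPM 0 (π.matchTo p),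
    ∃ i, f ⟨_, h⟩ = Sum.inr i ∧ n = .app i

/-- `K` contains the root and, for every node in `K` and every premiss, a child carrying it. -/
def Covers (π : DerivTree Sig) (K : Set (List ℕ)) : Prop :=
  [] ∈ K ∧ ∀ p ∈ K, ∀ i, π.label p = some (.app i) → ∀ Δ ∈ i.prem,
    ∃ k, p ++ [k] ∈ K ∧ i.prem[k]? = some Δ

theorem covers_univ (π : DerivTree Sig) : π.Covers Set.univ :=
  ⟨trivial, fun _ _ _ _ _ hΔ => by simpa using List.mem_iff_getElem?.1 hΔ⟩

variable {f : ProverStrategy Sig} {K : Set (List ℕ)}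

/-- Guided play never leaves the part `K` of the tree: Prover's move is the instance at the current
node, and the premiss chosen by Refuter is carried by a child in `K`. -/
theorem Follows.guided_cases (hf : Follows f π K) (hK : π.Covers K) (hΓ : π.Concludes Γ)
    {M : List (searchGame Sig).Board} (hM : (searchGame Sig).IsMatch M)
    (hh : M.head? = some (seqPos Γ)) (hg : f.Guides M) :
    (∃ p ∈ K, ∃ n, π.label p = some n ∧ M = π.matchTo p) ∨
      ∃ p ∈ K, ∃ i, π.label p = some (.app i) ∧ M = π.matchTo p ++ [instPos i] := by
  induction M using List.reverseRecOn with
  | nil => simp at hh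
  | append_singleton M c ih =>
    rcases eq_or_ne M [] with rfl | hne
    · obtain ⟨n, hn, e⟩ := hΓ.exists_label
      obtain rfl : c = seqPos Γ := by simpa using hh
      exact Or.inl ⟨[], hK.1, n, hn, by rw [matchTo_nil hn, e]; rfl⟩
    obtain ⟨hm, hE⟩ := (isMatch_concat hne).1 hM
    obtain ⟨hg1, hg2⟩ := Strategy.guides_concat.1 hg
    rw [List.head?_append_of_ne_nil _ hne] at hh
    rcases ih hm hh hg1 with ⟨p, hp, n, hn, rfl⟩ | ⟨p, hp, i, hi, rfl⟩
    · have hpm : (searchGame Sig).IsPM 0 (π.matchTo p) :=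
        isPM_of_concat hM (isMatch_matchTo hn).2 rfl
      obtain ⟨i, hi, rfl⟩ := hf p hp n hn hpm
      refine Or.inr ⟨p, hp, i, hn, ?_⟩
      rw [← hg2 hpm, hi]
    · obtain ⟨Δ, rfl, hΔ⟩ := searchMove_inr (hE (instPos i) (by simp))
      obtain ⟨k, hk, he⟩ := hK.2 p hp i hi Δ hΔ
      obtain ⟨m, hm, e⟩ := exists_label_concat hi he
      exact Or.inl ⟨_, hk, m, hm, by rw [matchTo_concat hi hm, e]; rfl⟩

theorem Follows.guided_isPM (hf : Follows f π K) (hK : π.Covers K) (hΓ : π.Concludes Γ)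
    {M : List (searchGame Sig).Board} (hM : (searchGame Sig).IsPM 0 M)
    (hh : M.head? = some (seqPos Γ)) (hg : f.Guides M) :
    ∃ p ∈ K, ∃ n, π.label p = some n ∧ M = π.matchTo p := by
  rcases hf.guided_cases hK hΓ hM.1 hh hg with h | ⟨p, -, i, -, rfl⟩
  · exact h
  · have := hM.2.2 (instPos i) (by simp)
    exact absurd this (by decide : ¬ (1 : Fin 2) = 0)

theorem Follows.guides_matchTo (hf : Follows f π Set.univ) (h : π.label p = some n) :
    f.Guides (π.matchTo p) := by
  induction p using List.reverseRecOn generalizing n with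
  | nil =>
    rw [matchTo_nil h]
    exact Strategy.guides_singleton _ _
  | append_singleton p k ih =>
    obtain ⟨i, hi, hk⟩ := exists_of_label_concat h
    rw [matchTo_concat hi h]
    refine Strategy.guides_concat.2 ⟨Strategy.guides_concat.2 ⟨ih hi, fun hpm => ?_⟩,
      fun hpm => ?_⟩
    · obtain ⟨j, hj, e⟩ := hf p trivial _ hi hpm
      cases e
      exact hj
    · have := hpm.2.2 (instPos i) (by simp)
      exact absurd this (by decide : ¬ (1 : Fin 2) = 0)

/-- The branch is built step by step, turning each premiss chosen by Refuter into the index of a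
child in `K`. This is what transfers the branch conditions of a proof to infinite matches. -/
theorem Follows.exists_tracks (hf : Follows f π K) (hK : π.Covers K) (hΓ : π.Concludes Γ)
    {M : ℕ → (searchGame Sig).Board} (hM : (searchGame Sig).IsInfMatch M) (h0 : M 0 = seqPos Γ)
    (hg : f.GuidesInf M) : ∃ x, π.Tracks x M := by
  have hnext : ∀ (p : List ℕ) (b : (searchGame Sig).Board), ∃ k, p ∈ K →
      ∀ i, π.label p = some (.app i) → ∀ Δ ∈ i.prem, b = seqPos Δ →
        p ++ [k] ∈ K ∧ i.prem[k]? = some Δ := by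
    intro p b
    by_cases h : ∃ i Δ, p ∈ K ∧ π.label p = some (.app i) ∧ Δ ∈ i.prem ∧ b = seqPos Δ
    · obtain ⟨i, Δ, hp, hi, hΔ, rfl⟩ := h
      obtain ⟨k, hk⟩ := hK.2 p hp i hi Δ hΔ
      refine ⟨k, fun _ j hj Δ' _ e => ?_⟩
      rw [hi, Option.some_inj] at hj
      cases hj
      obtain rfl : Δ = Δ' := Sum.inl_injective e
      exact hk
    · exact ⟨0, fun hp i hi Δ hΔ e => absurd ⟨i, Δ, hp, hi, hΔ, e⟩ h⟩
  choose next hnext using hnext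
  -- The node at depth `n` corresponds to position `2 * n`, so position `2 * n + 2` holds the
  -- premiss chosen there.
  let addr : ℕ → List ℕ := fun n => Nat.rec [] (fun n p => p ++ [next p (M (2 * n + 2))]) n
  let x : ℕ → ℕ := fun n => next (addr n) (M (2 * n + 2))
  have haddr : ∀ n, addr n = (List.range n).map x := by
    intro n
    induction n with
    | zero => rfl
    | succ n ih =>
      rw [List.range_succ, List.map_append, ← ih]
      rfl
  have hinst : ∀ n, (∃ m, π.label (addr n) = some m) →
      π.matchTo (addr n) = (List.range (2 * n + 1)).map M → addr n ∈ K →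
      ∃ i, π.label (addr n) = some (.app i) ∧ M (2 * n) = seqPos i.conc ∧
        M (2 * n + 1) = Sum.inr i := by
    rintro n ⟨m, hm⟩ hmt hn
    have hlast := (isMatch_matchTo hm).2
    have hpm : (searchGame Sig).IsPM 0 (π.matchTo (addr n)) := by
      refine isPM_of_concat (c := M (2 * n + 1)) ?_ hlast rfl
      rw [hmt]
      simpa [List.range_succ] using hM.isMatch_prefix (2 * n + 1)
    obtain ⟨i, hi, rfl⟩ := hf _ hn m hm hpm
    refine ⟨i, hm, ?_, ?_⟩
    · rw [hmt, List.range_succ, List.map_append, List.map_singleton, List.getLast?_append,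
        List.getLast?_singleton, Option.some_or, Option.some_inj] at hlast
      exact hlast
    · simp only [hmt] at hpm hi
      rw [← hi, hg _ hpm]
  have hinv : ∀ n, (∃ m, π.label (addr n) = some m) ∧
      π.matchTo (addr n) = (List.range (2 * n + 1)).map M ∧ addr n ∈ K := by
    intro n
    induction n with
    | zero =>
      obtain ⟨m, hm, e⟩ := hΓ.exists_label
      refine ⟨⟨m, hm⟩, ?_, hK.1⟩
      change π.matchTo [] = _
      rw [matchTo_nil hm, e]
      simp [List.range_succ, h0]
    | succ n ih =>
      obtain ⟨i, hi, -, h1⟩ := hinst n ih.1 ih.2.1 ih.2.2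
      have hE := hM (2 * n + 1)
      rw [h1] at hE
      obtain ⟨Δ, h2, hΔ⟩ := searchMove_inr hE
      obtain ⟨hk, he⟩ := hnext (addr n) _ ih.2.2 i hi Δ hΔ h2
      obtain ⟨m, hm, e⟩ := exists_label_concat hi he
      refine ⟨⟨m, hm⟩, ?_, hk⟩
      change π.matchTo (addr n ++ [_]) = _
      rw [matchTo_concat hi hm, ih.2.1, show 2 * (n + 1) + 1 = 2 * n + 1 + 1 + 1 by ring,
        List.range_succ (n := 2 * n + 1 + 1), List.range_succ (n := 2 * n + 1), List.map_append,
        List.map_append, List.map_singleton, List.map_singleton, h1, h2, e]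
      rfl
  refine ⟨x, fun k => ?_⟩
  rw [← haddr]
  exact hinst k (hinv k).1 (hinv k).2.1 (hinv k).2.2

theorem Follows.winningAt (hSig : NegationClosed Sig) (hf : Follows f π K) (hK : π.Covers K)
    (hπ : π.IsProofOf Γ) (hs : f.SurvivingAt (seqPos Γ)) : f.WinningAt (seqPos Γ) := by
  refine ⟨hs, fun M hM _ _ b hb ho => ?_, fun M hM h0 hg => ?_⟩
  · rcases b with Δ | i
    · obtain ⟨i, hi⟩ := exists_inst hSig Δ
      exact hM.2 _ hb (Sum.inr i) hi
    · exact absurd ho (by decide : ¬ (1 : Fin 2) = 0)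
  · obtain ⟨x, hx⟩ := hf.exists_tracks hK hπ.1 hM h0 hg
    exact searchGame_W_eq_zero (hx.proverCondition_iff.2
      ⟨hπ.2.focus x hx.isBranch, hπ.2.modal x hx.isBranch⟩)

/-- The hypothesis `hK` says that the label is a function of the history on `K`, which is what
defining a strategy there requires. At all other matches any admissible move will do. -/
theorem exists_follows
    (happ : ∀ p ∈ K, ∀ n, π.label p = some n → ∃ i, n = .app i)
    (hK : ∀ p ∈ K, ∀ q ∈ K, (π.label p).isSome → (π.label q).isSome →
      π.matchTo p = π.matchTo q → π.label p = π.label q) :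
    ∃ f : ProverStrategy Sig, f.SurvivingAt (seqPos Γ) ∧ Follows f π K := by
  have hmove : ∀ M : {M : List (searchGame Sig).Board // (searchGame Sig).IsPM 0 M},
      ∃ b, (∀ c ∈ M.1.getLast?, (searchGame Sig).E c b) ∧
        ∀ p ∈ K, ∀ n, π.label p = some n → π.matchTo p = M.1 →
          ∃ i, b = Sum.inr i ∧ n = .app i := by
    intro M
    by_cases h : ∃ p ∈ K, ∃ n, π.label p = some n ∧ π.matchTo p = M.1
    · obtain ⟨p, hp, n, hn, hM⟩ := h
      obtain ⟨i, rfl⟩ := happ p hp n hn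
      refine ⟨Sum.inr i, fun c hc => ?_, fun q hq m hm hM' => ⟨i, rfl, ?_⟩⟩
      · rw [← hM] at hc
        obtain rfl := Option.mem_unique hc (isMatch_matchTo hn).2
        exact (rfl : i.conc = i.conc)
      · have := hK p hp q hq (by simp [hn]) (by simp [hm]) (hM.trans hM'.symm)
        rw [hn, hm, Option.some_inj] at this
        exact this.symm
    · obtain ⟨b, c, hb, -, hE⟩ := M.2.exists_move
      exact ⟨c, fun d hd => Option.mem_unique hb hd ▸ hE,
        fun p hp n hn e => absurd ⟨p, hp, n, hn, e⟩ h⟩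
  choose f hf1 hf2 using hmove
  exact ⟨f, fun M _ => hf1 M, fun p hp n hn h => hf2 ⟨_, h⟩ p hp n hn rfl⟩

/-- The addresses that, at each step, use the first premiss equal to the given one. -/
inductive IsFirst (π : DerivTree Sig) : List ℕ → Prop
  | nil : IsFirst π []
  | concat {p : List ℕ} {i : InstOver Sig} {k : ℕ} (Δ : SeqOver Sig) : IsFirst π p → π.label p = some (.app i) →
      i.prem[k]? = some Δ → (∀ j < k, i.prem[j]? ≠ some Δ) → IsFirst π (p ++ [k])

theorem covers_isFirst (π : DerivTree Sig) : π.Covers {p | π.IsFirst p} := by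
  classical
  refine ⟨.nil, fun p hp i hi Δ hΔ => ?_⟩
  have h := List.mem_iff_getElem?.1 hΔ
  exact ⟨Nat.find h, .concat Δ hp hi (Nat.find_spec h) fun j hj => Nat.find_min h hj,
    Nat.find_spec h⟩

/-- The history records the instance and the chosen premiss at each step, and the least index of
that premiss is unique. -/
theorem IsFirst.eq_of_matchTo_eq {q : List ℕ} (hp : π.IsFirst p) (hq : π.IsFirst q)
    (hp' : (π.label p).isSome) (hq' : (π.label q).isSome) (h : π.matchTo p = π.matchTo q) :
    p = q := by
  obtain ⟨n, hn⟩ := Option.isSome_iff_exists.1 hp'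
  obtain ⟨m, hm⟩ := Option.isSome_iff_exists.1 hq'
  induction hp generalizing q n m with
  | nil =>
    have h1 := length_matchTo hm
    rw [← h, length_matchTo hn] at h1
    exact (List.length_eq_zero_iff.1 (by simpa using h1.symm)).symm
  | @concat p i k Δ hp hi hk hmin ih =>
    cases hq with
    | nil =>
      have h1 := length_matchTo hm
      rw [← h, length_matchTo hn] at h1
      simp at h1
    | @concat q j l Δ' hq hj hl hmin' =>
      rw [matchTo_concat hi hn, matchTo_concat hj hm] at h
      obtain ⟨h, h1⟩ := List.append_inj' h rfl
      obtain ⟨h3, h2⟩ := List.append_inj' h rfl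
      obtain rfl : i = j := Sum.inr_injective (List.singleton_injective h2)
      have h1 : n.conc = m.conc := Sum.inl_injective (List.singleton_injective h1)
      obtain rfl := ih hq (by simp [hi]) (by simp [hj]) h3 _ hi _ hj
      have e : ∀ {k n Δ}, π.label (p ++ [k]) = some n → i.prem[k]? = some Δ → n.conc = Δ := by
        intro k n Δ hn hk
        obtain ⟨i', hi', hk'⟩ := exists_of_label_concat hn
        rw [hi, Option.some_inj] at hi'
        cases hi'
        rw [hk, Option.some_inj] at hk'
        exact hk'.symm
      obtain rfl : Δ = Δ' := (e hn hk).symm.trans (h1.trans (e hm hl))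
      rcases lt_trichotomy k l with h3 | rfl | h3
      · exact absurd hk (hmin' k h3)
      · rfl
      · exact absurd hl (hmin l h3)

/-- Prover can play inside any proof, treating equal premisses equally. -/
theorem IsProofOf.exists_winningAt (hSig : NegationClosed Sig) (hπ : π.IsProofOf Γ) :
    ∃ f : ProverStrategy Sig, f.WinningAt (seqPos Γ) ∧
      ∀ M, M.1.head? = some (seqPos Γ) → f.Guides M.1 →
        ∃ p i, π.matchTo p = M.1 ∧ π.label p = some (.app i) ∧ f M = Sum.inr i := by
  obtain ⟨f, hs, hf⟩ := exists_follows (π := π) (K := {p | π.IsFirst p}) (Γ := Γ)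
    (fun p _ n hn => hπ.2.exists_app hn)
    (fun p hp q hq hp' hq' h => by rw [IsFirst.eq_of_matchTo_eq hp hq hp' hq' h])
  refine ⟨f, hf.winningAt hSig π.covers_isFirst hπ hs, fun M hh hg => ?_⟩
  obtain ⟨p, hp, n, hn, hM⟩ := hf.guided_isPM π.covers_isFirst hπ.1 M.2 hh hg
  obtain ⟨M, hpm⟩ := M
  subst hM
  obtain ⟨i, hi, rfl⟩ := hf p hp n hn hpm
  exact ⟨p, i, rfl, hn, hi⟩

end DerivTree

/-! ### Strategy trees -/

open DerivTree

variable {f : ProverStrategy Sig} {Γ : SeqOver Sig} {π : DerivTree Sig}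

theorem IsStrategyTree.follows (h : IsStrategyTree f Γ π) : Follows f π Set.univ :=
  fun p _ => h.2 p

theorem Follows.isStrategyTree (h : Follows f π Set.univ) (hΓ : π.Concludes Γ) :
    IsStrategyTree f Γ π :=
  ⟨hΓ, fun p => h p trivial⟩

/-- The history before the node `p` and the sequent at `p`, if at each node the instance `c L Δ` is
applied, where `Δ` is the sequent at the node and `L` is the history before it. -/
def playState (c : List (searchGame Sig).Board → SeqOver Sig → InstOver Sig) (Γ : SeqOver Sig)
    (p : List ℕ) : Option (List (searchGame Sig).Board × SeqOver Sig) :=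
  p.foldl (fun s k => s.bind fun x => ((c x.1 x.2).prem[k]?).map fun Δ =>
    (x.1 ++ [seqPos x.2] ++ [instPos (c x.1 x.2)], Δ)) (some ([], Γ))

theorem playState_concat (c : List (searchGame Sig).Board → SeqOver Sig → InstOver Sig)
    (Γ : SeqOver Sig) (p : List ℕ) (k : ℕ) :
    playState c Γ (p ++ [k]) = (playState c Γ p).bind fun x => ((c x.1 x.2).prem[k]?).map fun Δ =>
      (x.1 ++ [seqPos x.2] ++ [instPos (c x.1 x.2)], Δ) := by
  simp only [playState, List.foldl_append, List.foldl_cons, List.foldl_nil]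

/-- The tree that applies at each node the instance `c L Δ`, where `Δ` is the sequent at the node
and `L` is the history before it. -/
def treeOf (c : List (searchGame Sig).Board → SeqOver Sig → InstOver Sig)
    (hc : ∀ L Δ, (c L Δ).conc = Δ) (Γ : SeqOver Sig) : DerivTree Sig where
  label p := (playState c Γ p).map fun x => .app (c x.1 x.2)
  root := rfl
  child p k := by
    rw [playState_concat]
    cases playState c Γ p with
    | none => rfl
    | some x =>
      simp only [Option.bind_some, Option.map_some, Option.map_map]
      change Option.map (fun Δ => (c _ Δ).conc) _ = (c x.1 x.2).prem[k]?
      simp only [hc, Option.map_id']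

theorem matchTo_treeOf (c : List (searchGame Sig).Board → SeqOver Sig → InstOver Sig)
    (hc : ∀ L Δ, (c L Δ).conc = Δ) (Γ : SeqOver Sig) (p : List ℕ)
    (x : List (searchGame Sig).Board × SeqOver Sig) (hx : playState c Γ p = some x) :
    (treeOf c hc Γ).matchTo p = x.1 ++ [seqPos x.2] := by
  have hlab : ∀ {p x}, playState c Γ p = some x →
      (treeOf c hc Γ).label p = some (.app (c x.1 x.2)) := fun h => by
    simp only [treeOf, h, Option.map_some]
  induction p using List.reverseRecOn generalizing x with
  | nil =>
    rw [matchTo_nil (hlab hx)]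
    change [seqPos (c x.1 x.2).conc] = _
    rw [hc]
    obtain rfl : ([], Γ) = x := Option.some_inj.1 hx
    rfl
  | append_singleton p k ih =>
    have hx' := hx
    rw [playState_concat, Option.bind_eq_some_iff] at hx'
    obtain ⟨y, hy, hx'⟩ := hx'
    obtain ⟨Δ, -, rfl⟩ := Option.map_eq_some_iff.1 hx'
    rw [matchTo_concat (hlab hy) (hlab hx), ih y hy]
    change _ ++ [seqPos (c _ Δ).conc] = _
    rw [hc]

theorem exists_isStrategyTree (hSig : NegationClosed Sig) (hs : f.SurvivingAt (seqPos Γ)) :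
    ∃ π, IsStrategyTree f Γ π := by
  -- The strategy is known to move admissibly only after matches from `Γ`; for other histories an
  -- arbitrary instance makes the choice total, as `treeOf` demands.
  have hc : ∀ (L : List (searchGame Sig).Board) (Δ : SeqOver Sig), ∃ i : InstOver Sig,
      i.conc = Δ ∧ ∀ h : (searchGame Sig).IsPM 0 (L ++ [seqPos Δ]),
        (L ++ [seqPos Δ]).head? = some (seqPos Γ) → f ⟨_, h⟩ = Sum.inr i := by
    intro L Δ
    by_cases h : ∃ _ : (searchGame Sig).IsPM 0 (L ++ [seqPos Δ]),
      (L ++ [seqPos Δ]).head? = some (seqPos Γ)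
    · obtain ⟨h, hh⟩ := h
      obtain ⟨i, hi, e⟩ := searchMove_inl (hs ⟨_, h⟩ hh (seqPos Δ) (by simp))
      exact ⟨i, e, fun _ _ => hi⟩
    · obtain ⟨i, hi⟩ := exists_inst hSig Δ
      exact ⟨i, hi, fun h1 h2 => absurd ⟨h1, h2⟩ h⟩
  choose c hc hfc using hc
  have hΓ : (treeOf c hc Γ).Concludes Γ := congrArg some (hc [] Γ)
  refine ⟨treeOf c hc Γ, hΓ, fun p n hn h => ?_⟩
  have hh := head?_matchTo hΓ hn
  obtain ⟨x, hx, rfl⟩ := Option.map_eq_some_iff.1 hn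
  have e := matchTo_treeOf c hc Γ p x hx
  refine ⟨_, ?_, rfl⟩
  simp only [e] at h hh ⊢
  exact hfc _ _ h hh

/-- Labels and histories are compared simultaneously along addresses: equal histories receive the
same move of `f`, and this fixes the sequents and histories of the children. -/
theorem IsStrategyTree.unique (hSig : NegationClosed Sig) {π' : DerivTree Sig}
    (h : IsStrategyTree f Γ π) (h' : IsStrategyTree f Γ π') : π = π' := by
  have step : ∀ {p n m}, π.label p = some n → π'.label p = some m →
      π.matchTo p = π'.matchTo p → n = m := by
    intro p n m hn hm e
    obtain ⟨i, hi, rfl⟩ := h.2 p n hn (isPM_matchTo hSig hn)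
    obtain ⟨j, hj, rfl⟩ := h'.2 p m hm (isPM_matchTo hSig hm)
    simp only [e] at hi
    rw [Sum.inr_injective (hi.symm.trans hj)]
  have key : ∀ p, π.label p = π'.label p ∧
      ((π.label p).isSome → π.matchTo p = π'.matchTo p) := by
    intro p
    induction p using List.reverseRecOn with
    | nil =>
      obtain ⟨n, hn, e⟩ := h.1.exists_label
      obtain ⟨m, hm, e'⟩ := h'.1.exists_label
      have hmt : π.matchTo [] = π'.matchTo [] := by rw [matchTo_nil hn, matchTo_nil hm, e, e']
      exact ⟨by rw [hn, hm, step hn hm hmt], fun _ => hmt⟩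
    | append_singleton p k ih =>
      have hc : (π.label (p ++ [k])).map Node.conc = (π'.label (p ++ [k])).map Node.conc := by
        rw [π.child, π'.child, ih.1]
      rcases hn : π.label (p ++ [k]) with _ | n
      · rw [hn, Option.map_none, eq_comm, Option.map_eq_none_iff] at hc
        exact ⟨hc.symm, by simp⟩
      · rw [hn, Option.map_some, eq_comm] at hc
        obtain ⟨m, hm, e⟩ := Option.map_eq_some_iff.1 hc
        obtain ⟨i, hi, -⟩ := exists_of_label_concat hn
        have hmt : π.matchTo (p ++ [k]) = π'.matchTo (p ++ [k]) := by
          rw [matchTo_concat hi hn, matchTo_concat (ih.1 ▸ hi) hm, e, ih.2 (by simp [hi])]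
        exact ⟨by rw [hm, step hn hm hmt], fun _ => hmt⟩
  exact DerivTree.ext (funext fun p => (key p).1)

/-- Every infinite branch is tracked by a match guided by `f`, so Prover's winning condition gives
focus and modal steps on the branch. -/
theorem IsStrategyTree.isProofOf (hSig : NegationClosed Sig) (h : IsStrategyTree f Γ π)
    (hw : f.WinningAt (seqPos Γ)) : π.IsProofOf Γ := by
  have happ : ∀ {p n}, π.label p = some n → ∃ i, n = .app i := fun hn => by
    obtain ⟨i, -, e⟩ := h.2 _ _ hn (isPM_matchTo hSig hn)
    exact ⟨i, e⟩
  have hbranch : ∀ x, π.IsBranch x → ∃ M, π.Tracks x M ∧ ProverCondition Sig M := by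
    intro x hx
    have hi : ∀ k, ∃ i, π.label ((List.range k).map x) = some (.app i) := fun k => by
      obtain ⟨n, hn⟩ := Option.isSome_iff_exists.1 (hx k)
      obtain ⟨i, rfl⟩ := happ hn
      exact ⟨i, hn⟩
    choose i hi using hi
    let M : ℕ → (searchGame Sig).Board := fun n =>
      if n % 2 = 0 then seqPos (i (n / 2)).conc else instPos (i (n / 2))
    have h0 : ∀ k, M (2 * k) = seqPos (i k).conc := fun k => by simp [M]
    have h1 : ∀ k, M (2 * k + 1) = instPos (i k) := fun k => by
      simp only [M]
      rw [if_neg (by omega), show (2 * k + 1) / 2 = k by omega]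
    have ht : π.Tracks x M := fun k => ⟨i k, hi k, h0 k, h1 k⟩
    have hM : (searchGame Sig).IsInfMatch M := by
      intro n
      obtain ⟨k, rfl | rfl⟩ := Nat.even_or_odd' n
      · rw [h0, h1]
        exact (rfl : (i k).conc = (i k).conc)
      · rw [h1, show 2 * k + 1 + 1 = 2 * (k + 1) by ring, h0]
        have hk := hi (k + 1)
        rw [List.range_succ, List.map_append] at hk
        obtain ⟨j, hj, he⟩ := exists_of_label_concat hk
        rw [hi k, Option.some_inj] at hj
        cases hj
        exact (List.mem_of_getElem? he : (i (k + 1)).conc ∈ (i k).prem)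
    refine ⟨M, ht, ?_⟩
    have hW := hw.inf M hM ?_ ?_
    · by_contra hcon
      exact absurd (hW.symm.trans (searchGame_W_eq_one hcon)) (by decide)
    · obtain ⟨n, hn, e⟩ := h.1.exists_label
      have e0 := hi 0
      rw [List.range_zero, List.map_nil, hn, Option.some_inj] at e0
      subst e0
      exact (h0 0).trans (congrArg seqPos e)
    · intro n hpm
      obtain ⟨k, rfl | rfl⟩ := Nat.even_or_odd' n
      · have hmt := ht.matchTo k
        have hpm' := hpm
        rw [← hmt] at hpm'
        obtain ⟨j, hj, e⟩ := h.2 _ _ (hi k) hpm'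
        cases e
        simp only [hmt] at hj
        rw [h1, hj]
      · have := hpm.2.2 (instPos (i k)) (by rw [List.range_succ]; simp [h1])
        exact absurd this (by decide : ¬ (1 : Fin 2) = 0)
  refine ⟨h.1, fun p n hn hp => ?_, fun x hx => ?_, fun x hx => ?_⟩
  · obtain ⟨i, rfl⟩ := happ hn
    -- Only axioms have an empty list of premisses.
    refine ⟨i, rfl, RuleApp.isAxiom (Sig := Sig) (Γ := i.conc.1) ?_⟩
    have hv := i.valid
    rwa [show i.prem = [] from hp] at hv
  · obtain ⟨M, ht, hM⟩ := hbranch x hx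
    exact (ht.proverCondition_iff.1 hM).1
  · obtain ⟨M, ht, hM⟩ := hbranch x hx
    exact (ht.proverCondition_iff.1 hM).2

theorem IsStrategyTree.winningAt_iff (hSig : NegationClosed Sig) (h : IsStrategyTree f Γ π)
    (hs : f.SurvivingAt (seqPos Γ)) : f.WinningAt (seqPos Γ) ↔ π.IsProofOf Γ :=
  ⟨h.isProofOf hSig, fun hπ => h.follows.winningAt hSig π.covers_univ hπ hs⟩

/-- The `f`-guided matches from `Γ` that await a move of Prover are exactly the histories of nodes
of the tree. -/
theorem IsStrategyTree.iff_agree (h : IsStrategyTree f Γ π) (g : ProverStrategy Sig) :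
    IsStrategyTree g Γ π ↔ ∀ M, M.1.head? = some (seqPos Γ) → f.Guides M.1 → f M = g M := by
  constructor
  · rintro hg ⟨M, hM⟩ hh hgu
    obtain ⟨p, -, n, hn, rfl⟩ := h.follows.guided_isPM π.covers_univ h.1 hM hh hgu
    obtain ⟨i, hi, rfl⟩ := h.2 p n hn hM
    obtain ⟨j, hj, e⟩ := hg.2 p _ hn hM
    cases e
    exact hi.trans hj.symm
  · intro hag
    refine ⟨h.1, fun p n hn hpm => ?_⟩
    rw [← hag ⟨_, hpm⟩ (head?_matchTo h.1 hn) (h.follows.guides_matchTo hn)]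
    exact h.2 p n hn hpm

theorem IsStrategyTree.uniform (hSig : NegationClosed Sig) (h : IsStrategyTree f Γ π) :
    π.Uniform := by
  intro p q hp hq e
  obtain ⟨n, hn⟩ := Option.isSome_iff_exists.1 hp
  obtain ⟨m, hm⟩ := Option.isSome_iff_exists.1 hq
  obtain ⟨i, hi, rfl⟩ := h.2 p n hn (isPM_matchTo hSig hn)
  obtain ⟨j, hj, rfl⟩ := h.2 q m hm (isPM_matchTo hSig hm)
  simp only [e] at hi
  rw [hn, hm, Sum.inr_injective (hi.symm.trans hj)]

theorem DerivTree.IsProofOf.exists_isStrategyTree (hSig : NegationClosed Sig)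
    (hπ : π.IsProofOf Γ) (hu : π.Uniform) :
    ∃ f : ProverStrategy Sig, f.WinningAt (seqPos Γ) ∧ IsStrategyTree f Γ π := by
  obtain ⟨f, hs, hf⟩ := exists_follows (π := π) (K := Set.univ) (Γ := Γ)
    (fun p _ n hn => hπ.2.exists_app hn) (fun p _ q _ => hu p q)
  exact ⟨f, hf.winningAt hSig π.covers_univ hπ hs, Follows.isStrategyTree hf hπ.1⟩

/-- In the strategy tree of a positional strategy, the subtree at a node is determined by the
sequent at the node. -/
theorem IsStrategyTree.regular (hSig : NegationClosed Sig) (h : IsStrategyTree f Γ π)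
    (hpos : f.Positional) : π.Regular := by
  classical
  have step : ∀ {p q n m}, π.label p = some n → π.label q = some m → n.conc = m.conc → n = m := by
    intro p q n m hn hm e
    obtain ⟨i, hi, rfl⟩ := h.2 p n hn (isPM_matchTo hSig hn)
    obtain ⟨j, hj, rfl⟩ := h.2 q m hm (isPM_matchTo hSig hm)
    have := hpos ⟨_, isPM_matchTo hSig hn⟩ ⟨_, isPM_matchTo hSig hm⟩
      ((isMatch_matchTo hn).2.trans (e ▸ (isMatch_matchTo hm).2.symm))
    rw [Sum.inr_injective (hi.symm.trans (this.trans hj))]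
  have step' : ∀ {p q}, (π.label p).map Node.conc = (π.label q).map Node.conc →
      π.label p = π.label q := by
    intro p q e
    rcases hn : π.label p with _ | n <;> rcases hm : π.label q with _ | m <;> rw [hn, hm] at e
    · simp at e
    · simp at e
    · rw [step hn hm (Option.some_inj.1 e)]
  -- Positionality recovers the label from the sequent, and `child` computes the sequents below from
  -- the label, so agreement propagates through the subtrees, including absent addresses.
  have key : ∀ {p q}, (π.label p).map Node.conc = (π.label q).map Node.conc →
      ∀ r, π.label (p ++ r) = π.label (q ++ r) := by
    intro p q e r
    induction r using List.reverseRecOn with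
    | nil => simpa using step' e
    | append_singleton r k ih =>
      rw [← List.append_assoc, ← List.append_assoc]
      exact step' (by rw [π.child, π.child, ih])
  let g : SeqOver Sig → List ℕ → Option (Node Sig) := fun Δ =>
    if h : ∃ p, (π.label p).map Node.conc = some Δ then fun q => π.label (h.choose ++ q)
    else fun _ => none
  refine (Set.finite_range g).subset ?_
  rintro _ ⟨p, hp, rfl⟩
  obtain ⟨n, hn⟩ := Option.isSome_iff_exists.1 hp
  have hex : ∃ p, (π.label p).map Node.conc = some n.conc := ⟨p, by rw [hn]; rfl⟩
  refine ⟨n.conc, ?_⟩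
  simp only [g, dif_pos hex]
  exact funext fun r => key (hex.choose_spec.trans (by rw [hn]; rfl)) r

/-- A provable sequent has a positional winning strategy. -/
theorem exists_positional_winningAt {f : ProverStrategy Sig} (hf : f.WinningAt (seqPos Γ)) :
    ∃ g : ProverStrategy Sig, g.Positional ∧ g.WinningAt (seqPos Γ) := by
  obtain ⟨s, hs, hdet⟩ := (searchGame_isParity Sig).positionallyDetermined
  obtain ⟨pl, hpl⟩ := hdet (seqPos Γ)
  match pl with
  | 0 => exact ⟨s 0, hs 0, hpl⟩
  | 1 => exact (Strategy.not_winningAt_both f (s 1) _ hf hpl).elim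

end Trees

end FocusTwo
-- Assembly of the three claims
theorem mainTheorem3 {P D : Type*} [Countable P] [Infinite P] [Countable D] [Infinite D]
    [TwoWayActions D] (Sig : Finset (Formula P D)) (hAF : ∀ φ ∈ Sig, IsAFFormula φ)
    (hSig : NegationClosed Sig) :
    -- the proof search game is a finite parity game, whence positionally determined
    (Finite (searchGame Sig).Board ∧ (searchGame Sig).IsParity (searchPriority Sig) ∧
      (searchGame Sig).PositionallyDetermined) ∧
    -- proofs of `Γ` are winning strategies for Prover in the game initialised at `Γ`
    (∀ Γ : SeqOver Sig,
      (∀ f : ProverStrategy Sig, f.SurvivingAt (seqPos Γ) → ∃! π, IsStrategyTree f Γ π) ∧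
      (∀ (f : ProverStrategy Sig) (π : DerivTree Sig), f.SurvivingAt (seqPos Γ) →
        IsStrategyTree f Γ π → (f.WinningAt (seqPos Γ) ↔ π.IsProofOf Γ)) ∧
      (∀ f g : ProverStrategy Sig, f.SurvivingAt (seqPos Γ) → g.SurvivingAt (seqPos Γ) →
        ∀ π, IsStrategyTree f Γ π → (IsStrategyTree g Γ π ↔
          ∀ M, M.1.head? = some (seqPos Γ) → f.Guides M.1 → f M = g M)) ∧
      (∀ π : DerivTree Sig, π.IsProofOf Γ →
        ((∃ f : ProverStrategy Sig, f.WinningAt (seqPos Γ) ∧ IsStrategyTree f Γ π) ↔ π.Uniform)) ∧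
      (∀ π : DerivTree Sig, π.IsProofOf Γ →
        ∃ f : ProverStrategy Sig, f.WinningAt (seqPos Γ) ∧
          ∀ M, M.1.head? = some (seqPos Γ) → f.Guides M.1 →
            ∃ p i, π.matchTo p = M.1 ∧ π.label p = some (.app i) ∧ f M = Sum.inr i) ∧
      ((∃ π : DerivTree Sig, π.IsProofOf Γ) ↔
        ∃ f : ProverStrategy Sig, f.WinningAt (seqPos Γ))) ∧
    -- positional strategies give regular proofs, and every provable sequent has a regular proof
    (∀ Γ : SeqOver Sig,
      (∀ (f : ProverStrategy Sig) (π : DerivTree Sig), f.Positional → f.WinningAt (seqPos Γ) →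
        IsStrategyTree f Γ π → π.IsProofOf Γ ∧ π.Regular) ∧
      ((∃ π : DerivTree Sig, π.IsProofOf Γ) →
        (∃ f : ProverStrategy Sig, f.Positional ∧ f.WinningAt (seqPos Γ)) ∧
          ∃ π : DerivTree Sig, π.IsProofOf Γ ∧ π.Regular)) := by
  refine ⟨⟨finite_board, searchGame_isParity Sig, (searchGame_isParity Sig).positionallyDetermined⟩,
    fun Γ => ⟨fun f hf => ?_, fun f π hf h => h.winningAt_iff hSig hf,
      fun f g _ _ π h => h.iff_agree g,
      fun π hπ => ⟨fun ⟨f, _, h⟩ => h.uniform hSig, hπ.exists_isStrategyTree hSig⟩,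
      fun π hπ => hπ.exists_winningAt hSig, ⟨fun ⟨π, hπ⟩ => ?_, fun ⟨f, hf⟩ => ?_⟩⟩,
    fun Γ => ⟨fun f π hpos hf h => ⟨h.isProofOf hSig hf, h.regular hSig hpos⟩, fun ⟨π, hπ⟩ => ?_⟩⟩
  · obtain ⟨π, hπ⟩ := exists_isStrategyTree hSig hf
    exact ⟨π, hπ, fun π' hπ' => hπ'.unique hSig hπ⟩
  · obtain ⟨f, hf, -⟩ := hπ.exists_winningAt hSig
    exact ⟨f, hf⟩
  · obtain ⟨π, hπ⟩ := exists_isStrategyTree hSig hf.surviving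
    exact ⟨π, hπ.isProofOf hSig hf⟩
  -- The given proof is used only to exclude a win of Refuter; the regular proof is the tree of a
  -- positional strategy and may be unrelated to it.
  · obtain ⟨f, hf, -⟩ := hπ.exists_winningAt hSig
    obtain ⟨g, hpos, hg⟩ := exists_positional_winningAt hf
    obtain ⟨π', hπ'⟩ := exists_isStrategyTree hSig hg.surviving
    exact ⟨⟨g, hpos, hg⟩, π', hπ'.isProofOf hSig hg, hπ'.regular hSig hpos⟩
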